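/- Let $a_1,a_2$ be non-zero integers such that $X^2-a_1X+a_2$ is irreducible over $\mathbb{Q}$, let $a,b\in\overline{\mathbb{Q}}$ be its roots, let $\gamma=a/b$, assume that $\gamma$ is not a root of unity, and let $K=\mathbb{Q}(a)$, a quadratic field with discriminant $\Delta_K$. For a root of unity $\zeta\in K$ let $h(\zeta)$ be the largest integer $n\ge 1$ with $\zeta\gamma\in (K^\times)^n$, and let $h$ be the maximum of $h(\zeta)$ over all roots of unity $\zeta\in K$. Write $(m,n)$ for the gcd and $[m,n]$ for the lcm of $m$ and $n$, and $[\mathcal P]\in\{0,1\}$ for the truth value of a statement $\mathcal P$. For positive integers $n,d$, write $n\mid d^\infty$ if every prime factor of $n$ divides $d$, let $(n,d^\infty)$ be the largest divisor of $n$ all of whose prime factors divide $d$, and let $h_2=(h,2^\infty)$. For positive integers $m\mid n$ let $K_{n,m}=K(\zeta_n,\gamma^{1/m})$, where $\zeta_n$ is a primitive $n$-th root of unity, and for every integer $d\ge 1$ put $$\delta^+_\gamma(d)=\sum_{v\mid d^\infty}\ \sum_{u\mid d}\frac{\mu(u)}{[K_{dv,uv}:\mathbb{Q}]},$$ where $v$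 and $u$ run over positive integers and $\mu$ is the M\"obius function. Assume that $h=h(1)$, so that $\gamma$ has an $h_2$-th root $\gamma^{1/h_2}$ in $K$, and that $\mathcal{Q}:=[N_{K/\mathbb{Q}}(\gamma^{1/h_2})=1]$ equals $0$ (equivalently, $N_{K/\mathbb{Q}}(\gamma^{1/h_2})=-1$; in this case $\Delta_K>0$). Let $d$ be a positive even integer and $e=\Delta_K/(d,\Delta_K)$. Then the series over $v$ defining $\delta^+_\gamma(d)$ converges absolutely, and $$\delta^+_\gamma(d)=\frac{1}{2d}\left(\frac{1}{(h,d^\infty)}+[e\mid d^\infty]\cdot\frac{(h,d^\infty)}{[(h,d^\infty),e]^2}\right)\prod_{p\mid d}\frac{p^2}{p^2-1}.$$ -/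

import Mathlib

open Polynomial IntermediateField

noncomputable section

/-- The algebraic closure of the rational numbers, in which all fields below live. -/
abbrev QBar : Type := AlgebraicClosure ℚ

instance numberFieldAdjoin (a : QBar) : NumberField ℚ⟮a⟯ where
  to_charZero := inferInstance
  to_finiteDimensional := by
    have h : Algebra.IsAlgebraic ℚ QBar := AlgebraicClosure.isAlgebraic ℚ
    have hf : FiniteDimensional ℚ ℚ⟮a⟯ :=
      IntermediateField.adjoin.finiteDimensional (h.isAlgebraic a).isIntegral
    convert hf

/-- The characteristic polynomial `X² - a₁ X + a₂` of the Lucas sequence `U(a₁, a₂)`. -/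
def lucasPoly (a₁ a₂ : ℤ) : ℚ[X] := X ^ 2 - C (a₁ : ℚ) * X + C (a₂ : ℚ)

/-- The Iverson symbol `[P]`, as a real number. -/
def iverson (P : Prop) : ℝ := by
  classical exact if P then 1 else 0

/-- `n ∣ d^∞`: the positive integer `n` has no prime factor outside those of `d`. -/
def DvdInfty (n d : ℕ) : Prop := n ∈ Nat.factoredNumbers d.primeFactors

/-- `(n, d^∞)`, the largest divisor of `n ≥ 1` all of whose prime factors divide `d`. -/
def gcdInfty (n d : ℕ) : ℕ := ∏ p ∈ d.primeFactors, p ^ n.factorization p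

/-- `h(ζ)`: the largest `n ≥ 1` such that `ζ γ` is an `n`-th power in `K^×`. -/
def powerIndexAt {K : Type*} [Field K] (γ ζ : K) : ℕ :=
  sSup {n : ℕ | 1 ≤ n ∧ ∃ β : K, β ≠ 0 ∧ β ^ n = ζ * γ}

/-- `h`: the maximum of the `h(ζ)` over all roots of unity `ζ` of `K`. -/
def powerIndex {K : Type*} [Field K] (γ : K) : ℕ :=
  sSup {n : ℕ | ∃ ζ : K, (∃ k : ℕ, 1 ≤ k ∧ ζ ^ k = 1) ∧ n = powerIndexAt γ ζ}

/-- The boolean `𝒬 = [N_{K/ℚ}(γ^{1/h₂}) = 1]`, where `h₂ = (h, 2^∞)` and `γ^{1/h₂}` is an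
`h₂`-th root of `γ` in `K`. So `𝒬 = 0` says that `γ` has an `h₂`-th root in `K` whose norm
is not `1`. -/
def normBool {K : Type*} [Field K] [NumberField K] (γ : K) : ℕ := by
  classical exact
    if ∀ η : K, η ^ gcdInfty (powerIndex γ) 2 = γ → Algebra.norm ℚ η = 1 then 1 else 0

/-- The cyclotomic-Kummer field `K_{n,m} = K(ζ_n, γ^{1/m})`, for `m ∣ n`. All `n`-th roots of
unity and all `m`-th roots of `γ` are adjoined: as `m ∣ n`, this is the field generated over `K`
by one primitive `n`-th root of unity and one `m`-th root of `γ`. -/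
def kummerField (K : IntermediateField ℚ QBar) (γ : K) (n m : ℕ) : IntermediateField ℚ QBar :=
  K ⊔ IntermediateField.adjoin ℚ ({z : QBar | z ^ n = 1} ∪ {z : QBar | z ^ m = (γ : QBar)})

/-- The inner sum `∑_{u ∣ d} μ(u) / [K_{dv,uv} : ℚ]`. -/
def deltaPlusTerm (K : IntermediateField ℚ QBar) (γ : K) (d v : ℕ) : ℝ :=
  ∑ u ∈ d.divisors,
    (ArithmeticFunction.moebius u : ℝ) / (Module.finrank ℚ (kummerField K γ (d * v) (u * v)) : ℝ)

/-- `δ⁺_γ(d) = ∑_{v ∣ d^∞} ∑_{u ∣ d} μ(u) / [K_{dv,uv} : ℚ]`. -/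
def deltaPlus (K : IntermediateField ℚ QBar) (γ : K) (d : ℕ) : ℝ :=
  ∑' v : {v : ℕ // DvdInfty v d}, deltaPlusTerm K γ d v

/-- `Δ_K / (d, Δ_K)`, for a number field `K` with positive discriminant `Δ_K`. -/
def discrQuot (K : Type*) [Field K] [NumberField K] (d : ℕ) : ℕ :=
  (NumberField.discr K).natAbs / Nat.gcd d (NumberField.discr K).natAbs

end

/-!
Write `K = ℚ(a)`, `σ` for its conjugation and `Δ` for its discriminant. Since `𝒬 = 0`, the number
`h` is positive and even, `γ` is `β ^ h` for some `β ∈ K` of norm `-1`, and `β` is not a `p`-th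
power in `K` for any prime `p`, by maximality of `h` (`exists_root_of_norm_eq_neg_one`). As
`(β - σ β)² = (β + σ β)² + 4 > 0`, the field `K` is real, `K = ℚ(√D)` with `D > 0` squarefree.

The degree of `K_{n,m}` for `m ∣ n`, `n` even, comes from two facts.

* With `m' = m / gcd(m, h)`, one has `K_{n,m} = K(ζ_n)(β^{1/m'})`, of degree `m'` over `K(ζ_n)`:
  otherwise `β` would be a `p`-th power in `K(ζ_n)` for some prime `p`
  (`natDegree_minpoly_eq_of_pow_eq`). This field is abelian over `ℚ`. For odd `p`, as `ζ_p ∉ K`,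
  commutativity makes `β` a `p`-th power already in `K` (`exists_pow_eq_of_comm`). For `p = 2` the
  product `√β · σ √β` would be a square root of `-1` fixed by the automorphisms over the real field
  `K` (`sq_ne_of_mul_conj_eq_neg_one`).
* `[K(ζ_n) : ℚ]` is `φ(n)` if `K ⊆ ℚ(ζ_n)` and `2 φ(n)` otherwise, and `K ⊆ ℚ(ζ_n)` exactly if
  `Δ ∣ n` (`le_cyclotomicSubfield_iff_discr_dvd`). One direction uses Gauss sums. For the other,
  primes dividing `Δ` divide the discriminant of `ℚ(ζ_n)`, hence `n`; the power of `2` in `Δ` is then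
  read off from the roots of unity `i` or `ζ_8` that `√D` and Gauss sums generate.

Hence `1 / [K_{dv,uv} : ℚ] = (1 + [Δ ∣ dv]) gcd(uv, h) / (2 φ(dv) uv)`. Let `H = (h, d^∞)`. The sum
of `μ(u) gcd(uv, h) / u` over `u ∣ d` vanishes unless `H ∣ v`, when it is `H φ(d) / d`
(`sum_divisors_moebius_mul_gcd`); and `Δ ∣ dv` means `e ∣ v`. So the term of index `v` is
`H / (2d) · ([H ∣ v] + [[H, e] ∣ v]) / v²`, and the sum over `v` is an Euler product
(`hasSum_dvdInfty_inv_sq_of_dvd`).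
-/

/-! ### Quadratic extensions and their conjugation -/

section Embeddings

variable {F K Ω : Type*} [Field F] [CharZero F] [Field K] [Algebra F K] [Field Ω] [Algebra F Ω]
  [IsAlgClosed Ω] (hK : Module.finrank F K = 2) {f g : K →ₐ[F] Ω} (hfg : f ≠ g)

include hK hfg in
open scoped Classical in
/-- A quadratic extension has exactly two embeddings. -/
theorem univ_algHom_eq_pair [Fintype (K →ₐ[F] Ω)] :
    (Finset.univ : Finset (K →ₐ[F] Ω)) = {f, g} := by
  have : FiniteDimensional F K := Module.finite_of_finrank_pos (by omega)
  symm
  apply Finset.eq_univ_of_card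
  rw [Finset.card_pair hfg]
  have := AlgHom.card F K Ω
  rw [hK] at this
  convert this.symm

include hK hfg in
theorem eq_or_eq_of_finrank_eq_two (k : K →ₐ[F] Ω) : k = f ∨ k = g := by
  classical
  have : FiniteDimensional F K := Module.finite_of_finrank_pos (by omega)
  have h := Finset.mem_univ k
  rw [univ_algHom_eq_pair hK hfg, Finset.mem_insert, Finset.mem_singleton] at h
  exact h

include hK hfg in
theorem algebraMap_norm_eq_mul_of_ne (x : K) :
    algebraMap F Ω (Algebra.norm F x) = f x * g x := by
  classical
  have : FiniteDimensional F K := Module.finite_of_finrank_pos (by omega)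
  rw [Algebra.norm_eq_prod_embeddings F Ω, univ_algHom_eq_pair hK hfg, Finset.prod_pair hfg]

include hK hfg in
theorem algebraMap_trace_eq_add_of_ne (x : K) :
    algebraMap F Ω (Algebra.trace F K x) = f x + g x := by
  classical
  have : FiniteDimensional F K := Module.finite_of_finrank_pos (by omega)
  rw [trace_eq_sum_embeddings Ω, univ_algHom_eq_pair hK hfg, Finset.sum_pair hfg]

end Embeddings

section Conjugation

variable {F Ω : Type*} [Field F] [CharZero F] [Field Ω] [Algebra F Ω]

omit [CharZero F] in
theorem exists_algEquiv_ne_of_finrank_eq_two [IsGalois F Ω] {K : IntermediateField F Ω}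
    (hK : Module.finrank F K = 2) : ∃ σ : Ω ≃ₐ[F] Ω, ∃ x ∈ K, σ x ≠ x := by
  by_contra! H
  have hbot : K = ⊥ := by
    rw [eq_bot_iff]
    intro x hx
    exact (InfiniteGalois.mem_bot_iff_fixed (k := F) x).2 fun σ => H σ x hx
  rw [hbot, IntermediateField.finrank_bot] at hK
  omega

omit [CharZero F] in
theorem val_ne_comp_val {K : IntermediateField F Ω} {σ : Ω ≃ₐ[F] Ω} (hσ : ∃ x ∈ K, σ x ≠ x) :
    K.val ≠ (σ : Ω →ₐ[F] Ω).comp K.val := by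
  obtain ⟨x, hx, hne⟩ := hσ
  intro h
  exact hne (DFunLike.congr_fun h ⟨x, hx⟩).symm

variable [IsAlgClosed Ω] {K : IntermediateField F Ω} (hK : Module.finrank F K = 2)
  {σ : Ω ≃ₐ[F] Ω} (hσ : ∃ x ∈ K, σ x ≠ x)

include hK hσ in
theorem algebraMap_norm_eq_mul (x : K) :
    algebraMap F Ω (Algebra.norm F x) = x * σ x :=
  algebraMap_norm_eq_mul_of_ne hK (val_ne_comp_val hσ) x

include hK hσ in
theorem algebraMap_trace_eq_add (x : K) :
    algebraMap F Ω (Algebra.trace F K x) = x + σ x :=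
  algebraMap_trace_eq_add_of_ne hK (val_ne_comp_val hσ) x

include hK hσ in
theorem algEquiv_eq_id_or_eq_conj (τ : Ω ≃ₐ[F] Ω) :
    (∀ x ∈ K, τ x = x) ∨ (∀ x ∈ K, τ x = σ x) := by
  rcases eq_or_eq_of_finrank_eq_two hK (val_ne_comp_val hσ) ((τ : Ω →ₐ[F] Ω).comp K.val)
    with h | h
  · left; intro x hx; exact DFunLike.congr_fun h ⟨x, hx⟩
  · right; intro x hx; exact DFunLike.congr_fun h ⟨x, hx⟩

include hK hσ in
theorem conj_mem {x : Ω} (hx : x ∈ K) : σ x ∈ K := by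
  have h := algebraMap_trace_eq_add hK hσ ⟨x, hx⟩
  have : σ x = algebraMap F Ω (Algebra.trace F K ⟨x, hx⟩) - x := by rw [h]; ring
  rw [this]
  exact sub_mem (K.algebraMap_mem _) hx

include hK hσ in
theorem conj_conj {x : Ω} (hx : x ∈ K) : σ (σ x) = x := by
  have h1 := algebraMap_trace_eq_add hK hσ ⟨x, hx⟩
  have h2 : σ (algebraMap F Ω (Algebra.trace F K ⟨x, hx⟩)) = _ := σ.commutes _
  rw [h1, map_add] at h2
  exact add_left_cancel (a := σ x) (by rw [h2, add_comm])

include hK hσ in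
theorem exists_algebraMap_eq_of_conj_eq {x : Ω} (hx : x ∈ K) (h : σ x = x) :
    ∃ q : F, algebraMap F Ω q = x := by
  have : CharZero Ω := charZero_of_injective_algebraMap (algebraMap F Ω).injective
  refine ⟨Algebra.trace F K ⟨x, hx⟩ / 2, ?_⟩
  rw [map_div₀, algebraMap_trace_eq_add hK hσ ⟨x, hx⟩, h, map_ofNat]
  ring

include hK in
/-- Any two automorphisms commute on a quadratic extension. -/
theorem comm_apply_of_mem [IsGalois F Ω] (τ₁ τ₂ : Ω ≃ₐ[F] Ω) {x : Ω} (hx : x ∈ K) :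
    τ₁ (τ₂ x) = τ₂ (τ₁ x) := by
  obtain ⟨σ, hσ⟩ := exists_algEquiv_ne_of_finrank_eq_two hK
  have hx' := conj_mem hK hσ hx
  rcases algEquiv_eq_id_or_eq_conj hK hσ τ₁ with h1 | h1 <;>
  rcases algEquiv_eq_id_or_eq_conj hK hσ τ₂ with h2 | h2 <;>
  simp [h1 _ hx, h2 _ hx, h1 _ hx', h2 _ hx']

end Conjugation

section Real

variable {Ω : Type*} [Field Ω] [Algebra ℚ Ω] [IsAlgClosed Ω] [IsGalois ℚ Ω]
  {K : IntermediateField ℚ Ω} (hK : Module.finrank ℚ K = 2)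

include hK in
/-- A quadratic field that contains an irrational `√D` with `D > 0` is real, so it contains no
square root of a negative integer. -/
theorem sq_ne_neg_of_sqrt_mem {δ : Ω} {D : ℕ} (hδK : δ ∈ K) (hD : 0 < D)
    (hδ : δ ^ 2 = (D : Ω)) (hδQ : ∀ q : ℚ, algebraMap ℚ Ω q ≠ δ)
    {r : ℕ} (hr : 0 < r) {j : Ω} (hj : j ∈ K) : j ^ 2 ≠ -(r : Ω) := by
  intro hjr
  obtain ⟨σ, hσ⟩ := exists_algEquiv_ne_of_finrank_eq_two hK
  have key : ∀ (s : ℕ), 0 < s → ∀ q : ℚ, (algebraMap ℚ Ω q) ^ 2 ≠ -(s : Ω) := by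
    intro s hs q h
    have : q ^ 2 = -(s : ℚ) := by
      apply (algebraMap ℚ Ω).injective
      simpa using h
    have h1 := sq_nonneg q
    have h2 : (0 : ℚ) < s := by exact_mod_cast hs
    linarith
  have hσj : σ j = j ∨ σ j = -j := by
    apply sq_eq_sq_iff_eq_or_eq_neg.1
    rw [← map_pow, hjr]; simp
  have hσδ : σ δ = δ ∨ σ δ = -δ := by
    apply sq_eq_sq_iff_eq_or_eq_neg.1
    rw [← map_pow, hδ]; simp
  rcases hσδ with h | h
  · obtain ⟨q, hq⟩ := exists_algebraMap_eq_of_conj_eq hK hσ hδK h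
    exact hδQ q hq
  rcases hσj with h' | h'
  · obtain ⟨q, hq⟩ := exists_algebraMap_eq_of_conj_eq hK hσ hj h'
    exact key r hr q (by rw [hq, hjr])
  · obtain ⟨q, hq⟩ := exists_algebraMap_eq_of_conj_eq hK hσ (mul_mem hj hδK)
      (by rw [map_mul, h, h']; ring)
    refine key (r * D) (Nat.mul_pos hr hD) q ?_
    rw [hq, mul_pow, hjr, hδ]; push_cast; ring

omit [IsGalois ℚ Ω] in
include hK in
/-- If `β β' = -1`, then `(β - β')² = (β + β')² + 4 > 0`, so a quadratic field with an element
of norm `-1` is `ℚ(√D)` for a squarefree `D > 0`. -/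
theorem exists_sqrt_of_mul_conj_eq_neg_one {σ : Ω ≃ₐ[ℚ] Ω} (hσ : ∃ x ∈ K, σ x ≠ x) {β : Ω}
    (hβK : β ∈ K) (hβ : β * σ β = -1) :
    ∃ (D : ℕ) (δ : Ω), Squarefree D ∧ 0 < D ∧ δ ∈ K ∧ δ ^ 2 = (D : Ω) ∧
      ∀ q : ℚ, algebraMap ℚ Ω q ≠ δ := by
  obtain ⟨t, hT⟩ : ∃ t : ℚ, algebraMap ℚ Ω t = β + σ β :=
    ⟨_, algebraMap_trace_eq_add hK hσ ⟨β, hβK⟩⟩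
  set q : ℚ := t ^ 2 + 4 with hq
  have hq0 : 0 < q := by positivity
  have hnum : 0 < q.num := Rat.num_pos.2 hq0
  obtain ⟨D, s, hDs, hD⟩ := Nat.sq_mul_squarefree (q.num.natAbs * q.den)
  have hND : 0 < q.num.natAbs * q.den :=
    Nat.mul_pos (Int.natAbs_pos.2 hnum.ne') q.den_pos
  have hs : s ≠ 0 := by
    rintro rfl
    rw [← hDs] at hND
    simp at hND
  have hD0 : 0 < D := Nat.pos_of_ne_zero hD.ne_zero
  have hqq : q * q.den ^ 2 = D * s ^ 2 := by
    have h1 : (q.num.natAbs : ℚ) = q.num := by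
      rw [Nat.cast_natAbs, abs_of_pos hnum]
    have h2 : ((q.num.natAbs * q.den : ℕ) : ℚ) = s ^ 2 * D := by rw [← hDs]; push_cast; ring
    push_cast at h2
    rw [h1] at h2
    have h3 := Rat.mul_den_eq_num q
    calc q * q.den ^ 2 = (q * q.den) * q.den := by ring
      _ = q.num * q.den := by rw [h3]
      _ = _ := by rw [h2]; ring
  have : CharZero Ω := algebraRat.charZero Ω
  have hs' : (s : Ω) ≠ 0 := by exact_mod_cast hs
  have hsq : (β - σ β) ^ 2 = algebraMap ℚ Ω q := by
    rw [hq, map_add, map_pow, hT]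
    have h4 : algebraMap ℚ Ω 4 = 4 := by simp
    rw [h4]
    linear_combination -4 * hβ
  refine ⟨D, (β - σ β) * q.den / s, hD, hD0, ?_, ?_, ?_⟩
  · refine div_mem (mul_mem (sub_mem hβK (conj_mem hK hσ hβK)) ?_) ?_
    · exact K.natCast_mem _
    · exact K.natCast_mem _
  · rw [div_pow, mul_pow, hsq, div_eq_iff (pow_ne_zero 2 hs')]
    have := congrArg (algebraMap ℚ Ω) hqq
    simpa using this
  · intro r hr
    -- a rational square root would be fixed by `σ`, hence zero
    have h1 : σ ((β - σ β) * q.den / s) = (β - σ β) * q.den / s := by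
      rw [← hr]; exact σ.commutes r
    have h2 : σ ((β - σ β) * q.den / s) = -((β - σ β) * q.den / s) := by
      simp only [map_div₀, map_mul, map_sub, conj_conj hK hσ hβK, map_natCast]
      ring
    have h3 : (β - σ β) * q.den / s = 0 := by
      have := h1.symm.trans h2
      exact self_eq_neg.1 this
    have h4 : (β - σ β) = 0 := by
      have hden : (q.den : Ω) ≠ 0 := by exact_mod_cast q.den_ne_zero
      simpa [hs', hden] using h3
    rw [h4] at hsq
    have : q = 0 := by
      apply (algebraMap ℚ Ω).injective
      rw [← hsq]; simp
    linarith

end Real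

/-! ### The discriminant of a quadratic field -/

section Discriminant

open NumberField

variable {K : Type*} [Field K] [NumberField K] (hK : Module.finrank ℚ K = 2)

/-- The Gram determinant of a pair in a quadratic extension, through its two embeddings. -/
theorem gram_det_eq {F K Ω : Type*} [Field F] [CharZero F] [Field K] [Algebra F K] [Field Ω]
    [Algebra F Ω] [IsAlgClosed Ω] (hK : Module.finrank F K = 2) {f g : K →ₐ[F] Ω} (hfg : f ≠ g)
    (b : Fin 2 → K) :
    algebraMap F Ω (Algebra.discr F b) = (f (b 0) * g (b 1) - g (b 0) * f (b 1)) ^ 2 := by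
  rw [Algebra.discr_def, Matrix.det_fin_two]
  simp only [Algebra.traceMatrix_apply, Algebra.traceForm_apply, map_sub, map_mul,
    algebraMap_trace_eq_add_of_ne hK hfg]
  ring

include hK in
theorem exists_basis_fin_two : ∃ b : Module.Basis (Fin 2) ℤ (𝓞 K),
    discr K = Algebra.discr ℤ b := by
  have hcard : Fintype.card (Module.Free.ChooseBasisIndex ℤ (𝓞 K)) = 2 := by
    rw [← Module.finrank_eq_card_chooseBasisIndex, RingOfIntegers.rank, hK]
  let b := (RingOfIntegers.basis K).reindex (Fintype.equivFinOfCardEq hcard)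
  exact ⟨b, (discr_eq_discr K b).symm⟩

include hK in
theorem exists_algHom_ne : ∃ f g : K →ₐ[ℚ] AlgebraicClosure K, f ≠ g := by
  have h := AlgHom.card ℚ K (AlgebraicClosure K)
  rw [hK] at h
  exact Fintype.exists_pair_of_one_lt_card (by omega)

include hK in
/-- Stickelberger's congruence for quadratic fields: the discriminant is `(x y' - x' y)²` for an
integral basis `x, y`, which is `(x y' + x' y)² - 4 N(x) N(y)`. -/
theorem exists_discr_eq_sq_sub : ∃ s m : ℤ, discr K = s ^ 2 - 4 * m := by
  obtain ⟨b, hb⟩ := exists_basis_fin_two hK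
  obtain ⟨f, g, hfg⟩ := exists_algHom_ne hK
  refine ⟨Algebra.trace ℤ (𝓞 K) (b 0) * Algebra.trace ℤ (𝓞 K) (b 1) -
    Algebra.trace ℤ (𝓞 K) (b 0 * b 1),
    Algebra.norm ℤ (b 0) * Algebra.norm ℤ (b 1), ?_⟩
  apply (algebraMap ℤ (AlgebraicClosure K)).injective_int
  have htr : ∀ x : 𝓞 K, algebraMap ℤ (AlgebraicClosure K) (Algebra.trace ℤ (𝓞 K) x) =
      f x + g x := by
    intro x
    rw [← algebraMap_trace_eq_add_of_ne hK hfg, ← Algebra.coe_trace_int]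
    simp
  have hnm : ∀ x : 𝓞 K, algebraMap ℤ (AlgebraicClosure K) (Algebra.norm ℤ x) =
      f x * g x := by
    intro x
    rw [← algebraMap_norm_eq_mul_of_ne hK hfg, ← Algebra.coe_norm_int]
    simp
  rw [hb, Algebra.discr_def, Matrix.det_fin_two]
  simp only [Algebra.traceMatrix_apply, Algebra.traceForm_apply, map_sub, map_mul, map_pow, htr,
    hnm, map_ofNat]
  ring

include hK in
/-- The discriminant of a pair of integers is a square times the discriminant of the field. -/
theorem exists_discr_pair_eq (x y : 𝓞 K) :
    ∃ k : ℤ, Algebra.discr ℚ ![(x : K), (y : K)] = ((k ^ 2 * discr K : ℤ) : ℚ) := by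
  obtain ⟨b, hb⟩ := exists_basis_fin_two hK
  refine ⟨(b.toMatrix ![x, y]).det, ?_⟩
  have h1 : Algebra.discr ℤ ![x, y] = (b.toMatrix ![x, y]).det ^ 2 * discr K := by
    rw [hb, ← Algebra.discr_of_matrix_vecMul]
    congr 1
    funext i
    have := b.sum_toMatrix_smul_self ![x, y] i
    rw [← this, Matrix.vecMul, dotProduct]
    refine Finset.sum_congr rfl fun j _ => ?_
    simp [Algebra.smul_def, mul_comm]
  rw [← h1, Algebra.discr_def, Algebra.discr_def, Matrix.det_fin_two, Matrix.det_fin_two]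
  simp only [Algebra.traceMatrix_apply, Algebra.traceForm_apply]
  simp [← map_mul, ← Algebra.coe_trace_int]

theorem squarefree_sq_mul_eq {D : ℕ} (hD : Squarefree D) {k Δ : ℤ} (h : (D : ℤ) = k ^ 2 * Δ) :
    Δ = D := by
  have h1 : k.natAbs * k.natAbs ∣ D := by
    rw [← Int.natCast_dvd_natCast, h, Nat.cast_mul, Int.natCast_natAbs, abs_mul_abs_self, ← sq]
    exact Dvd.intro _ rfl
  have h2 := Nat.isUnit_iff.1 (hD _ h1)
  have h3 : k ^ 2 = 1 := by rw [← Int.natAbs_sq, h2]; rfl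
  rw [h, h3, one_mul]

include hK in
/-- The discriminant of `ℚ(√D)` for squarefree `D > 0`. -/
theorem discr_eq_of_sq_eq {D : ℕ} (hD : Squarefree D) {δ : K} (hδ : δ ^ 2 = (D : K))
    (hδQ : ∀ q : ℚ, algebraMap ℚ K q ≠ δ) :
    discr K = if D % 4 = 1 then (D : ℤ) else 4 * D := by
  obtain ⟨f, g, hfg⟩ := exists_algHom_ne hK
  have hD4 : D % 4 ≠ 0 := by
    intro h
    have := hD 2 (by omega)
    rw [Nat.isUnit_iff] at this
    omega
  have hfδ : g δ = - f δ := by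
    have h1 : g δ = f δ ∨ g δ = - f δ := by
      apply sq_eq_sq_iff_eq_or_eq_neg.1
      rw [← map_pow, ← map_pow, hδ, map_natCast, map_natCast]
    refine h1.resolve_left fun h2 => hδQ (Algebra.trace ℚ K δ / 2) ?_
    apply (f : K →+* AlgebraicClosure K).injective
    change f _ = f _
    rw [f.commutes, map_div₀, algebraMap_trace_eq_add_of_ne hK hfg, h2, map_ofNat]
    ring
  have hint : IsIntegral ℤ δ := by
    refine ⟨X ^ 2 - C (D : ℤ), monic_X_pow_sub_C _ two_ne_zero, ?_⟩
    simp [hδ]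
  have hf2 : f δ ^ 2 = (D : AlgebraicClosure K) := by rw [← map_pow, hδ, map_natCast]
  obtain ⟨s, m, hsm⟩ := exists_discr_eq_sq_sub hK
  split_ifs with hmod
  · -- `(1 + √D) / 2` is integral and generates a ring of discriminant `D`
    have hθ : IsIntegral ℤ ((1 + δ) / 2) := by
      refine ⟨X ^ 2 - X - C ((D / 4 : ℕ) : ℤ), ?_, ?_⟩
      · rw [sub_sub]
        apply monic_X_pow_sub
        compute_degree
        norm_num
      · have h4 : (D : K) = 4 * ((D / 4 : ℕ) : K) + 1 := by
          have : D = 4 * (D / 4) + 1 := by omega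
          exact_mod_cast this
        simp only [eval₂_sub, eval₂_pow, eval₂_X, eval₂_C]
        rw [h4] at hδ
        simp only [map_natCast]
        linear_combination (1 / 4) * hδ
    obtain ⟨k, hk⟩ := exists_discr_pair_eq hK (1 : 𝓞 K) ⟨_, hθ⟩
    have hf' : f 2 = 2 := map_ofNat f 2
    have hg' : g 2 = 2 := map_ofNat g 2
    refine squarefree_sq_mul_eq hD (k := k) ?_
    have h5 := gram_det_eq hK hfg ![((1 : 𝓞 K) : K), (1 + δ) / 2]
    have h6 : algebraMap ℚ (AlgebraicClosure K)
        (Algebra.discr ℚ ![((1 : 𝓞 K) : K), (1 + δ) / 2]) = (D : AlgebraicClosure K) := by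
      rw [h5]
      simp [hfδ, hf', hg']
      rw [← hf2]; ring
    have hk' : Algebra.discr ℚ ![((1 : 𝓞 K) : K), (1 + δ) / 2] = ((k ^ 2 * discr K : ℤ) : ℚ) := hk
    rw [hk'] at h6
    have h7 : ((k ^ 2 * discr K : ℤ) : AlgebraicClosure K) = ((D : ℤ) : AlgebraicClosure K) := by
      simpa using h6
    exact (Int.cast_injective h7).symm
  · obtain ⟨k, hk⟩ := exists_discr_pair_eq hK (1 : 𝓞 K) ⟨_, hint⟩
    have h5 := gram_det_eq hK hfg ![((1 : 𝓞 K) : K), δ]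
    have h6 : algebraMap ℚ (AlgebraicClosure K)
        (Algebra.discr ℚ ![((1 : 𝓞 K) : K), δ]) = 4 * (D : AlgebraicClosure K) := by
      rw [h5]
      simp [hfδ]
      rw [← hf2]; ring
    have hk' : Algebra.discr ℚ ![((1 : 𝓞 K) : K), δ] = ((k ^ 2 * discr K : ℤ) : ℚ) := hk
    rw [hk'] at h6
    have h7 : ((k ^ 2 * discr K : ℤ) : AlgebraicClosure K) =
        ((4 * D : ℤ) : AlgebraicClosure K) := by
      simpa using h6
    have h8 : k ^ 2 * discr K = 4 * D := Int.cast_injective h7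
    rcases Int.even_or_odd' k with ⟨l, rfl | rfl⟩
    · -- an even index would give discriminant `D`, against Stickelberger's congruence
      exfalso
      have h9 : (D : ℤ) = l ^ 2 * discr K := by linarith
      have h10 := squarefree_sq_mul_eq hD h9
      rw [h10] at hsm
      rcases Int.even_or_odd' s with ⟨r, rfl | rfl⟩
      · have : (D : ℤ) = 4 * (r ^ 2 - m) := by linarith
        omega
      · have : (D : ℤ) = 4 * (r ^ 2 + r - m) + 1 := by linarith
        omega
    · have hcop : IsCoprime ((2 * l + 1) ^ 2 : ℤ) 4 := ⟨1, -(l ^ 2 + l), by ring⟩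
      obtain ⟨c, hc⟩ : (4 : ℤ) ∣ discr K :=
        hcop.symm.dvd_of_dvd_mul_left ⟨D, h8⟩
      rw [hc] at h8 ⊢
      have h9 : (D : ℤ) = (2 * l + 1) ^ 2 * c := by linarith
      rw [squarefree_sq_mul_eq hD h9]

end Discriminant

/-! ### Quadratic subfields of cyclotomic fields -/

section Cyclotomic

/-- The subfield of `Ω` generated over `F` by all `n`-th roots of unity. -/
abbrev cyclotomicSubfield (F Ω : Type*) [Field F] [Field Ω] [Algebra F Ω] (n : ℕ) :
    IntermediateField F Ω := adjoin F {z : Ω | z ^ n = 1}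

variable {F Ω : Type*} [Field F] [Field Ω] [Algebra F Ω]

theorem mem_cyclotomicSubfield {n : ℕ} {z : Ω} (hz : z ^ n = 1) : z ∈ cyclotomicSubfield F Ω n :=
  subset_adjoin F _ hz

theorem cyclotomicSubfield_mono {m n : ℕ} (h : m ∣ n) :
    cyclotomicSubfield F Ω m ≤ cyclotomicSubfield F Ω n := by
  apply adjoin.mono
  rintro z (hz : z ^ m = 1)
  obtain ⟨k, rfl⟩ := h
  change z ^ (m * k) = 1
  rw [pow_mul, hz, one_pow]

theorem exists_isPrimitiveRoot_of_isAlgClosed [CharZero F] [IsAlgClosed Ω] {n : ℕ} (hn : n ≠ 0) :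
    ∃ ζ : Ω, IsPrimitiveRoot ζ n := by
  have : CharZero Ω := charZero_of_injective_algebraMap (algebraMap F Ω).injective
  have : NeZero (n : Ω) := ⟨Nat.cast_ne_zero.2 hn⟩
  have : NeZero n := ⟨hn⟩
  exact HasEnoughRootsOfUnity.exists_primitiveRoot Ω n

theorem cyclotomicSubfield_le_of_mem {E : IntermediateField F Ω} {n : ℕ} (hn : n ≠ 0) {ζ : Ω}
    (hζ : IsPrimitiveRoot ζ n) (hmem : ζ ∈ E) : cyclotomicSubfield F Ω n ≤ E := by
  have : NeZero n := ⟨hn⟩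
  rw [cyclotomicSubfield, adjoin_le_iff]
  intro z hz
  obtain ⟨i, -, rfl⟩ := hζ.eq_pow_of_pow_eq_one hz
  exact pow_mem hmem i

theorem isCyclotomicExtension_cyclotomicSubfield [CharZero F] [IsAlgClosed Ω] {n : ℕ}
    (hn : n ≠ 0) : IsCyclotomicExtension {n} F (cyclotomicSubfield F Ω n) := by
  have : NeZero n := ⟨hn⟩
  obtain ⟨ζ, hζ⟩ := exists_isPrimitiveRoot_of_isAlgClosed (F := F) (Ω := Ω) hn
  rw [IntermediateField.isCyclotomicExtension_singleton_iff_eq_adjoin n F Ω _ hζ]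
  apply le_antisymm
  · exact cyclotomicSubfield_le_of_mem hn hζ (mem_adjoin_simple_self F ζ)
  · rw [adjoin_simple_le_iff]
    exact mem_cyclotomicSubfield hζ.pow_eq_one

theorem isGalois_cyclotomicSubfield [CharZero F] [IsAlgClosed Ω] {n : ℕ} (hn : n ≠ 0) :
    IsGalois F (cyclotomicSubfield F Ω n) := by
  have : NeZero n := ⟨hn⟩
  have := isCyclotomicExtension_cyclotomicSubfield (F := F) (Ω := Ω) hn
  exact IsCyclotomicExtension.isGalois {n} F _

theorem exists_gaussSum_sq [CharZero F] [IsAlgClosed Ω] {p : ℕ} (hp : p.Prime) (hp2 : p ≠ 2) :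
    ∃ x ∈ cyclotomicSubfield F Ω p, x ^ 2 = ((ZMod.χ₄ p * p : ℤ) : Ω) := by
  have : Fact p.Prime := ⟨hp⟩
  have : CharZero Ω := charZero_of_injective_algebraMap (algebraMap F Ω).injective
  obtain ⟨ζ, hζ⟩ := exists_isPrimitiveRoot_of_isAlgClosed (F := F) (Ω := Ω) hp.ne_zero
  set ψ := AddChar.zmodChar p hζ.pow_eq_one with hψ
  set χ : MulChar (ZMod p) Ω := (quadraticChar (ZMod p)).ringHomComp (Int.castRingHom Ω) with hχ
  have hchar : ringChar (ZMod p) ≠ 2 := by rwa [ZMod.ringChar_zmod_n]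
  refine ⟨gaussSum χ ψ, ?_, ?_⟩
  · rw [gaussSum]
    refine sum_mem fun a _ => mul_mem ?_ ?_
    · exact intCast_mem (cyclotomicSubfield F Ω p) _
    · rw [hψ, AddChar.zmodChar_apply]
      exact pow_mem (mem_cyclotomicSubfield hζ.pow_eq_one) _
  · rw [gaussSum_sq (χ := χ) ?_ ?_ (AddChar.zmodChar_primitive_of_primitive_root p hζ), ZMod.card,
      hχ, MulChar.ringHomComp_apply, quadraticChar_neg_one hchar, ZMod.card]
    · simp
    · exact (MulChar.ringHomComp_ne_one_iff (RingHom.injective_int _)).2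
        (quadraticChar_ne_one hchar)
    · exact (quadraticChar_isQuadratic _).comp _

/-- For odd `k`, the `k`-th cyclotomic field contains a square root of `±k ≡ 1 (mod 4)`. -/
theorem exists_sq_eq_χ₄_mul [CharZero F] [IsAlgClosed Ω] {k : ℕ} (hk : Odd k) :
    ∃ x ∈ cyclotomicSubfield F Ω k, x ^ 2 = ((ZMod.χ₄ k * k : ℤ) : Ω) := by
  induction k using induction_on_primes with
  | zero => simp at hk
  | one => exact ⟨1, one_mem _, by simp⟩
  | prime_mul p m hp ih =>
    obtain ⟨h1, h2⟩ := Nat.odd_mul.1 hk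
    obtain ⟨x, hx, hx2⟩ := exists_gaussSum_sq (F := F) (Ω := Ω) hp
      (by rintro rfl; exact absurd h1 (by decide))
    obtain ⟨y, hy, hy2⟩ := ih h2
    refine ⟨x * y, mul_mem (cyclotomicSubfield_mono (Dvd.intro _ rfl) hx)
      (cyclotomicSubfield_mono (Dvd.intro_left _ rfl) hy), ?_⟩
    rw [mul_pow, hx2, hy2]
    push_cast
    rw [map_mul]
    push_cast
    ring

theorem finrank_cyclotomicSubfield_of_irreducible [CharZero F] [IsAlgClosed Ω] {n : ℕ}
    (hn : n ≠ 0) (hirr : Irreducible (cyclotomic n F)) :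
    Module.finrank F (cyclotomicSubfield F Ω n) = n.totient := by
  have : NeZero n := ⟨hn⟩
  have := isCyclotomicExtension_cyclotomicSubfield (F := F) (Ω := Ω) hn
  exact IsCyclotomicExtension.finrank _ hirr

end Cyclotomic

section Rational

variable {Ω : Type*} [Field Ω] [Algebra ℚ Ω] [IsAlgClosed Ω]

/-- The same fact for the algebra structure that `NumberField` uses. -/
theorem isCyclotomicExtension_cyclotomicSubfield_rat {n : ℕ} (hn : n ≠ 0) :
    @IsCyclotomicExtension {n} ℚ (cyclotomicSubfield ℚ Ω n) _ _ DivisionRing.toRatAlgebra := by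
  convert isCyclotomicExtension_cyclotomicSubfield (F := ℚ) (Ω := Ω) hn using 1
  · rfl
  · exact Subsingleton.elim _ _

theorem finrank_cyclotomicSubfield {n : ℕ} (hn : n ≠ 0) :
    Module.finrank ℚ (cyclotomicSubfield ℚ Ω n) = n.totient :=
  finrank_cyclotomicSubfield_of_irreducible hn (cyclotomic.irreducible_rat (Nat.pos_of_ne_zero hn))

/-- For even `n`, all roots of unity of the `n`-th cyclotomic field are `n`-th roots of unity. -/
theorem dvd_of_mem_cyclotomicSubfield {n l : ℕ} (hn : n ≠ 0) (hn2 : 2 ∣ n) (hl : l ≠ 0) {ξ : Ω}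
    (hξ : IsPrimitiveRoot ξ l) (hmem : ξ ∈ cyclotomicSubfield ℚ Ω n) : l ∣ n := by
  obtain ⟨ζ, hζ⟩ := exists_isPrimitiveRoot_of_isAlgClosed (F := ℚ) (Ω := Ω) hn
  have hN := Nat.lcm_ne_zero hl hn
  have hle : cyclotomicSubfield ℚ Ω (l.lcm n) ≤ cyclotomicSubfield ℚ Ω n :=
    cyclotomicSubfield_le_of_mem hN (hξ.pow_mul_pow_lcm hζ hl hn)
      (mul_mem (pow_mem hmem _) (pow_mem (mem_cyclotomicSubfield hζ.pow_eq_one) _))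
  have hfin : FiniteDimensional ℚ (cyclotomicSubfield ℚ Ω n) :=
    Module.finite_of_finrank_pos (by
      rw [finrank_cyclotomicSubfield hn]; exact Nat.totient_pos.2 (Nat.pos_of_ne_zero hn))
  have hφ : (l.lcm n).totient ≤ n.totient := by
    rw [← finrank_cyclotomicSubfield (Ω := Ω) hN, ← finrank_cyclotomicSubfield (Ω := Ω) hn]
    exact Submodule.finrank_mono (s := (cyclotomicSubfield ℚ Ω (l.lcm n)).toSubmodule)
      (t := (cyclotomicSubfield ℚ Ω n).toSubmodule) hle
  have hdvd := Nat.dvd_lcm_right l n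
  have heq : n = l.lcm n := (even_iff_two_dvd.2 hn2).eq_of_totient_eq_totient hdvd
    (le_antisymm (Nat.le_of_dvd (Nat.totient_pos.2 (Nat.pos_of_ne_zero hN))
      (Nat.totient_dvd_of_dvd hdvd)) hφ)
  rw [heq]
  exact Nat.dvd_lcm_left l n

theorem prime_dvd_of_dvd_discr {n : ℕ} (hn : n ≠ 0) {K : IntermediateField ℚ Ω}
    [NumberField K] (hK : K ≤ cyclotomicSubfield ℚ Ω n) {p : ℕ} (hp : p.Prime)
    (hpK : (p : ℤ) ∣ NumberField.discr K) : p ∣ n := by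
  have : NeZero n := ⟨hn⟩
  have h2 := isCyclotomicExtension_cyclotomicSubfield_rat (Ω := Ω) hn
  have h3 := IsCyclotomicExtension.numberField {n} ℚ (cyclotomicSubfield ℚ Ω n)
  let : Algebra K (cyclotomicSubfield ℚ Ω n) := (IntermediateField.inclusion hK).toAlgebra
  have h5 := hpK.trans (NumberField.discr_dvd_discr K (cyclotomicSubfield ℚ Ω n))
  rw [IsCyclotomicExtension.Rat.discr n (cyclotomicSubfield ℚ Ω n)] at h5
  have h6 : (p : ℤ) ∣ (n : ℤ) ^ n.totient := by
    refine (((Int.isUnit_iff.2 (neg_one_pow_eq_or ℤ _)).dvd_mul_left).1 h5).trans ?_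
    refine Int.ediv_dvd_of_dvd ?_
    have := Nat.prod_primeFactors_pow_totient_ediv_dvd (n := n) (Nat.pos_of_ne_zero hn)
    exact_mod_cast this
  exact hp.dvd_of_dvd_pow (by exact_mod_cast h6)

theorem eq_bot_or_eq_of_le_of_finrank_eq_two {F Ω : Type*} [Field F] [Field Ω] [Algebra F Ω]
    {E K : IntermediateField F Ω} (hK : Module.finrank F K = 2) (h : E ≤ K) : E = ⊥ ∨ E = K := by
  have : FiniteDimensional F K := Module.finite_of_finrank_pos (by omega)
  have hdvd := IntermediateField.finrank_dvd_of_le_right h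
  rw [hK, Nat.dvd_prime Nat.prime_two] at hdvd
  rcases hdvd with h1 | h1
  · exact Or.inl (IntermediateField.finrank_eq_one_iff.1 h1)
  · exact Or.inr (IntermediateField.eq_of_le_of_finrank_eq h (h1.trans hK.symm))

theorem quadratic_le_iff_sqrt_mem {F Ω : Type*} [Field F] [Field Ω] [Algebra F Ω]
    {E K : IntermediateField F Ω} (hK : Module.finrank F K = 2) {δ : Ω} (hδK : δ ∈ K)
    (hδF : ∀ q : F, algebraMap F Ω q ≠ δ) : K ≤ E ↔ δ ∈ E := by
  refine ⟨fun h => h hδK, fun h => ?_⟩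
  rcases eq_bot_or_eq_of_le_of_finrank_eq_two hK (adjoin_simple_le_iff.2 hδK) with h1 | h1
  · obtain ⟨q, hq⟩ := IntermediateField.mem_bot.1 (h1 ▸ mem_adjoin_simple_self F δ)
    exact absurd hq (hδF q)
  · rw [← h1]
    exact adjoin_simple_le_iff.2 h

theorem mem_of_sq_eq_sq {F Ω : Type*} [Field F] [Field Ω] [Algebra F Ω]
    {E : IntermediateField F Ω} {x y : Ω} (hy : y ∈ E) (h : x ^ 2 = y ^ 2) : x ∈ E := by
  rcases sq_eq_sq_iff_eq_or_eq_neg.1 h with rfl | rfl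
  · exact hy
  · exact neg_mem hy

theorem isPrimitiveRoot_four_of_sq_eq_neg_one {Ω : Type*} [Field Ω] [CharZero Ω] {i : Ω}
    (hi : i ^ 2 = -1) : IsPrimitiveRoot i 4 := by
  have h1 : IsPrimitiveRoot (i ^ 2) 2 := by
    rw [hi]; exact IsPrimitiveRoot.neg_one 0 (by norm_num)
  refine (IsPrimitiveRoot.iff_def _ _).2 ⟨?_, fun l hl => ?_⟩
  · rw [show 4 = 2 * 2 from rfl, pow_mul, h1.pow_eq_one]
  · have h2 : 2 ∣ l := (h1.pow_eq_one_iff_dvd l).1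
      (by rw [← pow_mul, mul_comm, pow_mul, hl, one_pow])
    obtain ⟨m, rfl⟩ := h2
    rw [pow_mul, h1.pow_eq_one_iff_dvd] at hl
    exact mul_dvd_mul_left 2 hl

/-- `(1 + i) / √(±2)` is a primitive eighth root of unity. -/
theorem isPrimitiveRoot_eight {Ω : Type*} [Field Ω] [CharZero Ω] {i s : Ω}
    (hi : i ^ 2 = -1) (hs : s ^ 2 = 2 ∨ s ^ 2 = -2) : IsPrimitiveRoot ((1 + i) / s) 8 := by
  have h1 : ((1 + i) / s) ^ 2 = i ∨ ((1 + i) / s) ^ 2 = -i := by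
    have h2 : (1 + i) ^ 2 = 2 * i := by linear_combination hi
    rw [div_pow, h2]
    rcases hs with hs | hs
    · left; rw [hs]; field_simp
    · right; rw [hs]; field_simp
  have h2 : IsPrimitiveRoot (((1 + i) / s) ^ 2) 4 := by
    apply isPrimitiveRoot_four_of_sq_eq_neg_one
    rcases h1 with h1 | h1 <;> rw [h1] <;> simp [hi]
  refine (IsPrimitiveRoot.iff_def _ _).2 ⟨?_, fun l hl => ?_⟩
  · rw [show 8 = 2 * 4 from rfl, pow_mul, h2.pow_eq_one]
  · have h4 : 4 ∣ l := (h2.pow_eq_one_iff_dvd l).1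
      (by rw [← pow_mul, mul_comm, pow_mul, hl, one_pow])
    obtain ⟨m, rfl⟩ := (show 2 ∣ 4 by norm_num).trans h4
    rw [pow_mul, h2.pow_eq_one_iff_dvd] at hl
    exact mul_dvd_mul_left 2 hl

theorem χ₄_eq_one_or_neg_one {k : ℕ} (hk : Odd k) : ZMod.χ₄ k = 1 ∨ ZMod.χ₄ k = -1 := by
  rw [ZMod.χ₄_eq_neg_one_pow (Nat.odd_iff.1 hk)]
  exact neg_one_pow_eq_or ℤ _

theorem exists_sq_eq_neg_one_mem {n : ℕ} (h4 : 4 ∣ n) :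
    ∃ i ∈ cyclotomicSubfield ℚ Ω n, i ^ 2 = -1 := by
  obtain ⟨i, hi⟩ := IsAlgClosed.exists_pow_nat_eq (-1 : Ω) (n := 2) (by norm_num)
  refine ⟨i, cyclotomicSubfield_mono h4 (mem_cyclotomicSubfield ?_), hi⟩
  rw [show 4 = 2 * 2 from rfl, pow_mul, hi]; norm_num

/-- A square root of `±k ≡ 1 (mod 4)`, for odd `k`, lies in all cyclotomic fields of level
divisible by `k`. -/
theorem mem_of_sq_eq_χ₄_mul {k n : ℕ} (hk : Odd k) (hkn : k ∣ n) {x : Ω}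
    (hx : x ^ 2 = ((ZMod.χ₄ k * k : ℤ) : Ω)) : x ∈ cyclotomicSubfield ℚ Ω n := by
  obtain ⟨y, hy, hy2⟩ := exists_sq_eq_χ₄_mul (F := ℚ) (Ω := Ω) hk
  exact mem_of_sq_eq_sq (cyclotomicSubfield_mono hkn hy) (hx.trans hy2.symm)

theorem sqrt_mem_iff_of_mod_four_eq_three {n D : ℕ} (hn : n ≠ 0) (hn2 : 2 ∣ n)
    (hD : D % 4 = 3) {δ : Ω} (hδ : δ ^ 2 = (D : Ω)) (hDn : D ∣ n) :
    δ ∈ cyclotomicSubfield ℚ Ω n ↔ 4 ∣ n := by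
  have : CharZero Ω := algebraRat.charZero Ω
  have hD0 : (D : Ω) ≠ 0 := by
    rw [Nat.cast_ne_zero]; rintro rfl; simp at hD
  have hDodd : Odd D := Nat.odd_iff.2 (by omega)
  obtain ⟨x, hx, hx2⟩ := exists_sq_eq_χ₄_mul (F := ℚ) (Ω := Ω) hDodd
  rw [ZMod.χ₄_nat_three_mod_four hD] at hx2
  have hxn := cyclotomicSubfield_mono hDn hx
  constructor
  · intro h
    have hi : (x / δ) ^ 2 = -1 := by
      rw [div_pow, hx2, hδ, div_eq_iff hD0]; push_cast; ring
    exact dvd_of_mem_cyclotomicSubfield hn hn2 (by norm_num)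
      (isPrimitiveRoot_four_of_sq_eq_neg_one hi) (div_mem hxn h)
  · intro h
    obtain ⟨i, hi, hi2⟩ := exists_sq_eq_neg_one_mem (Ω := Ω) h
    refine mem_of_sq_eq_sq (mul_mem hi hxn) ?_
    rw [hδ, mul_pow, hi2, hx2]; push_cast; ring

theorem sqrt_mem_iff_of_eq_two_mul_odd {n D k : ℕ} (hn : n ≠ 0) (hn2 : 2 ∣ n)
    (hk : Odd k) (hD : D = 2 * k) {δ : Ω} (hδ : δ ^ 2 = (D : Ω)) (hkn : k ∣ n) :
    δ ∈ cyclotomicSubfield ℚ Ω n ↔ 8 ∣ n := by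
  have : CharZero Ω := algebraRat.charZero Ω
  have hk0 : (k : Ω) ≠ 0 := by
    rw [Nat.cast_ne_zero]; rintro rfl; simp at hk
  obtain ⟨x, hx, hx2⟩ := exists_sq_eq_χ₄_mul (F := ℚ) (Ω := Ω) hk
  have hxn := cyclotomicSubfield_mono hkn hx
  have hx0 : x ≠ 0 := by
    rintro rfl
    rcases χ₄_eq_one_or_neg_one hk with h | h <;> rw [h] at hx2 <;>
      exact hk0 (by simpa using hx2.symm)
  have hs : (δ / x) ^ 2 = 2 ∨ (δ / x) ^ 2 = -2 := by
    rcases χ₄_eq_one_or_neg_one hk with h | h <;> rw [h] at hx2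
    · left
      rw [div_pow, hδ, hx2, hD]; push_cast; field_simp
    · right
      rw [div_pow, hδ, hx2, hD]; push_cast; field_simp
  have hδx : δ = δ / x * x := (div_mul_cancel₀ δ hx0).symm
  constructor
  · intro h
    -- adjoining `i` enlarges the level to `lcm 4 n`, whose divisibility by `8` is that of `n`
    obtain ⟨i, hi, hi2⟩ := exists_sq_eq_neg_one_mem (Ω := Ω) (Nat.dvd_lcm_left 4 n)
    have hsub := cyclotomicSubfield_mono (F := ℚ) (Ω := Ω) (Nat.dvd_lcm_right 4 n)
    have h8 : 8 ∣ Nat.lcm 4 n := dvd_of_mem_cyclotomicSubfield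
      (Nat.lcm_ne_zero (by norm_num) hn) (hn2.trans (Nat.dvd_lcm_right 4 n)) (by norm_num)
      (isPrimitiveRoot_eight hi2 hs)
      (div_mem (add_mem (one_mem _) hi) (hsub (div_mem h hxn)))
    obtain ⟨m, rfl⟩ := hn2
    rcases Nat.even_or_odd' m with ⟨l, rfl | rfl⟩
    · rwa [Nat.lcm_eq_right ⟨l, by ring⟩] at h8
    · have h4 := h8.trans (Nat.lcm_dvd (Dvd.intro (2 * l + 1) rfl)
        (⟨2, by ring⟩ : 2 * (2 * l + 1) ∣ 4 * (2 * l + 1)))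
      omega
  · intro h
    obtain ⟨i, hi, hi2⟩ := exists_sq_eq_neg_one_mem (Ω := Ω) ((by norm_num : 4 ∣ 8).trans h)
    have hδx0 : δ / x ≠ 0 := by
      intro h0; rw [h0] at hs; norm_num at hs
    have hξ := isPrimitiveRoot_eight hi2 hs
    have hξn := mem_cyclotomicSubfield (F := ℚ) ((hξ.pow_eq_one_iff_dvd n).2 h)
    have h1i : (1 + i) / (δ / x) ≠ 0 := hξ.ne_zero (by norm_num)
    have : δ / x = (1 + i) / ((1 + i) / (δ / x)) := by
      rw [div_div_cancel₀]
      rintro h0; rw [h0, zero_div] at h1i; exact h1i rfl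
    rw [hδx, this]
    exact mul_mem (div_mem (add_mem (one_mem _) hi) hξn) hxn

/-- For even `n`, the real quadratic field `ℚ(√D)` lies in the `n`-th cyclotomic field if and only
if its discriminant divides `n`. -/
theorem le_cyclotomicSubfield_iff_discr_dvd {K : IntermediateField ℚ Ω} [NumberField K]
    (hK : Module.finrank ℚ K = 2) {D : ℕ} (hD : Squarefree D) {δ : Ω} (hδK : δ ∈ K)
    (hδ : δ ^ 2 = (D : Ω)) (hδQ : ∀ q : ℚ, algebraMap ℚ Ω q ≠ δ) {n : ℕ} (hn : n ≠ 0)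
    (hn2 : 2 ∣ n) :
    K ≤ cyclotomicSubfield ℚ Ω n ↔ (NumberField.discr K).natAbs ∣ n := by
  have hdiscr : NumberField.discr K = if D % 4 = 1 then (D : ℤ) else 4 * D := by
    refine discr_eq_of_sq_eq ?_ hD (δ := ⟨δ, hδK⟩) ?_ ?_
    · convert hK
      exact congrArg (@Algebra.toModule ℚ K _ _) (Subsingleton.elim _ K.algebra')
    · exact Subtype.ext (by simpa using hδ)
    · intro q hq
      apply hδQ q
      have h1 := congrArg (algebraMap K Ω) hq
      have h2 : algebraMap K Ω (algebraMap ℚ K q) = algebraMap ℚ Ω q := by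
        rw [← RingHom.comp_apply]
        exact DFunLike.congr_fun (Subsingleton.elim _ _) q
      rw [← h2, h1]
      rfl
  have hD4 : D % 4 ≠ 0 := by
    intro h
    have := hD 2 (by omega)
    rw [Nat.isUnit_iff] at this
    omega
  have hDd : (D : ℤ) ∣ NumberField.discr K := by
    rw [hdiscr]; split_ifs
    · exact dvd_rfl
    · exact Dvd.intro_left _ rfl
  have hdvd : K ≤ cyclotomicSubfield ℚ Ω n → D ∣ n := by
    intro h
    rw [← Nat.prod_primeFactors_of_squarefree hD]
    refine (Finset.prod_dvd_prod_of_subset _ _ _ ?_).trans (Nat.prod_primeFactors_dvd n)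
    intro p hp
    have hpp := Nat.prime_of_mem_primeFactors hp
    exact Nat.mem_primeFactors.2 ⟨hpp, prime_dvd_of_dvd_discr hn h hpp
      ((Int.natCast_dvd_natCast.2 (Nat.dvd_of_mem_primeFactors hp)).trans hDd), hn⟩
  have hmem := quadratic_le_iff_sqrt_mem (E := cyclotomicSubfield ℚ Ω n) hK hδK hδQ
  rw [hdiscr]
  have h123 : D % 4 = 1 ∨ D % 4 = 3 ∨ D % 4 = 2 := by omega
  rcases h123 with h1 | h3 | h2
  · rw [if_pos h1, Int.natAbs_natCast]
    refine ⟨hdvd, fun h => hmem.2 ?_⟩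
    refine mem_of_sq_eq_χ₄_mul (Nat.odd_iff.2 (by omega)) h ?_
    rw [hδ, ZMod.χ₄_nat_one_mod_four h1]; simp
  · rw [if_neg (by omega), Int.natAbs_mul, Int.natAbs_natCast]
    change _ ↔ 4 * D ∣ n
    have hcop : Nat.Coprime 4 D := Nat.Coprime.pow_left 2
      (Nat.coprime_two_left.2 (Nat.odd_iff.2 (by omega)))
    constructor
    · intro h
      exact hcop.mul_dvd_of_dvd_of_dvd
        ((sqrt_mem_iff_of_mod_four_eq_three hn hn2 h3 hδ (hdvd h)).1 (hmem.1 h)) (hdvd h)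
    · intro h
      exact hmem.2 ((sqrt_mem_iff_of_mod_four_eq_three hn hn2 h3 hδ
        ((Dvd.intro_left _ rfl).trans h)).2 ((Dvd.intro _ rfl).trans h))
  · obtain ⟨k, hk⟩ : 2 ∣ D := by omega
    have hkodd : Odd k := Nat.odd_iff.2 (by omega)
    rw [if_neg (by omega), Int.natAbs_mul, Int.natAbs_natCast]
    change _ ↔ 4 * D ∣ n
    rw [hk, show 4 * (2 * k) = 8 * k by ring]
    have hcop : Nat.Coprime 8 k := Nat.Coprime.pow_left 3 (Nat.coprime_two_left.2 hkodd)
    constructor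
    · intro h
      have hkn : k ∣ n := (hk ▸ Dvd.intro_left _ rfl : k ∣ D).trans (hdvd h)
      exact hcop.mul_dvd_of_dvd_of_dvd
        ((sqrt_mem_iff_of_eq_two_mul_odd hn hn2 hkodd hk hδ hkn).1 (hmem.1 h)) hkn
    · intro h
      exact hmem.2 ((sqrt_mem_iff_of_eq_two_mul_odd hn hn2 hkodd hk hδ
        ((Dvd.intro_left _ rfl).trans h)).2 ((Dvd.intro _ rfl).trans h))

end Rational

/-! ### Powers in abelian extensions -/

section Abelian

variable {F Ω : Type*} [Field F] [Field Ω] [Algebra F Ω]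

theorem comm_apply_of_pow_eq_one {n : ℕ} (hn : n ≠ 0) (τ₁ τ₂ : Ω ≃ₐ[F] Ω) {z : Ω}
    (hz : z ^ n = 1) : τ₁ (τ₂ z) = τ₂ (τ₁ z) := by
  have : NeZero n := ⟨hn⟩
  obtain ⟨a, ha⟩ := rootsOfUnity.integer_power_of_ringEquiv n (τ₁ : Ω ≃+* Ω)
  obtain ⟨b, hb⟩ := rootsOfUnity.integer_power_of_ringEquiv n (τ₂ : Ω ≃+* Ω)
  have h1 := ha (rootsOfUnity.mkOfPowEq z hz)
  have h2 := hb (rootsOfUnity.mkOfPowEq z hz)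
  simp at h1 h2
  rw [h1, h2, map_zpow₀, map_zpow₀, h1, h2, ← zpow_mul, ← zpow_mul, mul_comm]

/-- The subfield of elements on which two automorphisms commute. -/
def commField (τ₁ τ₂ : Ω ≃ₐ[F] Ω) : IntermediateField F Ω :=
  (AlgHom.equalizer ((τ₁ * τ₂ : Ω ≃ₐ[F] Ω) : Ω →ₐ[F] Ω)
    ((τ₂ * τ₁ : Ω ≃ₐ[F] Ω) : Ω →ₐ[F] Ω)).toIntermediateField (by
      intro x hx
      rw [AlgHom.mem_equalizer] at hx ⊢
      rw [map_inv₀, map_inv₀, hx])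

theorem mem_commField {τ₁ τ₂ : Ω ≃ₐ[F] Ω} {x : Ω} :
    x ∈ commField τ₁ τ₂ ↔ τ₁ (τ₂ x) = τ₂ (τ₁ x) := Iff.rfl

/-- Any two automorphisms commute on the compositum of a quadratic extension with a cyclotomic
one. -/
theorem comm_apply_of_mem_sup [CharZero F] [IsAlgClosed Ω] [IsGalois F Ω]
    {K : IntermediateField F Ω} (hK : Module.finrank F K = 2) {n : ℕ} (hn : n ≠ 0)
    (τ₁ τ₂ : Ω ≃ₐ[F] Ω) {x : Ω}
    (hx : x ∈ K ⊔ cyclotomicSubfield F Ω n) : τ₁ (τ₂ x) = τ₂ (τ₁ x) := by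
  have hle : K ⊔ cyclotomicSubfield F Ω n ≤ commField τ₁ τ₂ := by
    refine sup_le (fun y hy => mem_commField.2 (comm_apply_of_mem hK τ₁ τ₂ hy)) ?_
    rw [adjoin_le_iff]
    exact fun z hz => mem_commField.2 (comm_apply_of_pow_eq_one hn τ₁ τ₂ hz)
  exact mem_commField.1 (hle hx)

/-- An element outside an intermediate field is moved by an automorphism over that field. -/
theorem exists_algEquiv_fixing_ne [IsGalois F Ω] {K : IntermediateField F Ω} {x : Ω}
    (hx : x ∉ K) : ∃ τ : Ω ≃ₐ[F] Ω, (∀ y ∈ K, τ y = y) ∧ τ x ≠ x := by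
  by_contra! H
  apply hx
  rw [← InfiniteGalois.fixedField_fixingSubgroup K]
  rintro ⟨τ, hτ⟩
  exact H τ fun y hy => (IntermediateField.mem_fixingSubgroup_iff K τ).1 hτ y hy

/-- If `β β' = -1` and `√(-1) ∉ K`, then `√β` lies in no abelian extension: `√β √β'` would be a
square root of `-1` fixed by all of `Gal(Ω/K)`. -/
theorem sq_ne_of_mul_conj_eq_neg_one [IsGalois F Ω] {K : IntermediateField F Ω}
    (hi : ∀ j ∈ K, j ^ 2 ≠ -1) {σ : Ω ≃ₐ[F] Ω} {β s : Ω} (hβK : β ∈ K) (hβ : β * σ β = -1)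
    (hs : ∀ τ : Ω ≃ₐ[F] Ω, τ (σ s) = σ (τ s)) : s ^ 2 ≠ β := by
  intro hsβ
  have hj : (s * σ s) ^ 2 = -1 := by rw [mul_pow, ← map_pow, hsβ, hβ]
  obtain ⟨τ, hτK, hτ⟩ := exists_algEquiv_fixing_ne (fun h => hi _ h hj)
  apply hτ
  have h1 : τ s = s ∨ τ s = -s := by
    apply sq_eq_sq_iff_eq_or_eq_neg.1
    rw [← map_pow, hsβ, hτK _ hβK]
  rcases h1 with h1 | h1 <;> simp [hs, h1]

/-- If `s ^ p ∈ K` and `s` lies in an abelian extension containing a primitive `p`-th root of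
unity `ζ ∉ K`, then `s ^ p` is a `p`-th power in `K`: for `σ` over `K` with `σ ζ = ζ ^ c`, `c ≢ 1`
modulo `p`, the quotient `σ s / s ^ c` lies in `K`. -/
theorem exists_pow_eq_of_comm [IsGalois F Ω] {K : IntermediateField F Ω} {p : ℕ} (hp : p.Prime)
    {ζ : Ω} (hζ : IsPrimitiveRoot ζ p) (hζK : ζ ∉ K) {β s : Ω} (hβ0 : β ≠ 0) (hβK : β ∈ K)
    (hsβ : s ^ p = β) (hs : ∀ τ₁ τ₂ : Ω ≃ₐ[F] Ω, τ₁ (τ₂ s) = τ₂ (τ₁ s)) :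
    ∃ y ∈ K, y ^ p = β := by
  have hp0 : NeZero p := ⟨hp.ne_zero⟩
  have hs0 : s ≠ 0 := by rintro rfl; rw [zero_pow hp.ne_zero] at hsβ; exact hβ0 hsβ.symm
  obtain ⟨σ, hσK, hσ⟩ := exists_algEquiv_fixing_ne hζK
  obtain ⟨c, -, hc⟩ := hζ.eq_pow_of_pow_eq_one (ξ := σ ζ)
    (by rw [← map_pow, hζ.pow_eq_one, map_one])
  have hw : σ s / s ^ c ∈ K := by
    by_contra hw
    obtain ⟨τ, hτK, hτ⟩ := exists_algEquiv_fixing_ne hw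
    apply hτ
    obtain ⟨a, -, ha⟩ := hζ.eq_pow_of_pow_eq_one (ξ := τ s / s) (by
      rw [div_pow, ← map_pow, hsβ, hτK _ hβK, div_self hβ0])
    have hτs : τ s = ζ ^ a * s := by rw [ha, div_mul_cancel₀ _ hs0]
    have hζ0 : ζ ≠ 0 := hζ.ne_zero hp.ne_zero
    rw [map_div₀, hs τ σ, map_pow, hτs, map_mul, map_pow, ← hc, mul_pow, ← pow_mul, ← pow_mul,
      mul_comm c a, mul_div_mul_left _ _ (pow_ne_zero _ hζ0)]
  have hwp : (σ s / s ^ c) ^ p = β ^ (1 - c : ℤ) := by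
    rw [div_pow, ← map_pow, hsβ, hσK _ hβK, ← pow_mul, mul_comm c p, pow_mul, hsβ,
      zpow_sub₀ hβ0, zpow_one, zpow_natCast]
  have hcop : IsCoprime (1 - c : ℤ) (p : ℤ) := by
    rw [isCoprime_comm, Prime.coprime_iff_not_dvd (Nat.prime_iff_prime_int.1 hp)]
    intro hdvd
    apply hσ
    have h1 : ζ ^ (1 - c : ℤ) = 1 := (hζ.zpow_eq_one_iff_dvd _).2 hdvd
    rw [zpow_sub₀ (hζ.ne_zero hp.ne_zero), zpow_one, zpow_natCast,
      div_eq_one_iff_eq (pow_ne_zero _ (hζ.ne_zero hp.ne_zero))] at h1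
    rw [← hc, ← h1]
  obtain ⟨u, v, huv⟩ := hcop
  refine ⟨(σ s / s ^ c) ^ u * β ^ v, mul_mem (zpow_mem hw _) (zpow_mem hβK _), ?_⟩
  rw [mul_pow, ← zpow_natCast, ← zpow_mul, mul_comm u, zpow_mul, zpow_natCast, hwp, ← zpow_mul,
    ← zpow_natCast, ← zpow_mul, ← zpow_add₀ hβ0]
  rw [show (1 - c : ℤ) * u + v * p = 1 by linarith, zpow_one]

end Abelian

/-! ### Irreducibility of pure equations -/

/-- Over a field containing the `n`-th roots of unity, the degree `k` of a root `ρ` of `X ^ n - β`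
satisfies `ρ ^ k ∈ L`, since the product of the conjugates of `ρ` is `ρ ^ k` times a root of
unity. Hence `X ^ n - β` is irreducible as soon as `β` is not a `p`-th power for any prime
`p ∣ n`. -/
theorem natDegree_minpoly_eq_of_pow_eq {L Ω : Type*} [Field L] [Field Ω] [Algebra L Ω]
    [IsAlgClosed Ω] {n : ℕ} (hn : n ≠ 0) {β : L} (hβ0 : β ≠ 0)
    (hμ : ∀ z : Ω, z ^ n = 1 → z ∈ (algebraMap L Ω).fieldRange)
    (hβ : ∀ p : ℕ, p.Prime → p ∣ n → ∀ s : L, s ^ p ≠ β)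
    {ρ : Ω} (hρ : ρ ^ n = algebraMap L Ω β) : (minpoly L ρ).natDegree = n := by
  have hβ0' : algebraMap L Ω β ≠ 0 := by simpa using hβ0
  have hρ0 : ρ ≠ 0 := by rintro rfl; rw [zero_pow hn] at hρ; exact hβ0' hρ.symm
  have hroot : aeval ρ (X ^ n - C β) = 0 := by simp [hρ]
  have hint : IsIntegral L ρ := ⟨X ^ n - C β, monic_X_pow_sub_C β hn, hroot⟩
  have hdvd : minpoly L ρ ∣ X ^ n - C β := minpoly.dvd L ρ hroot
  set k := (minpoly L ρ).natDegree with hk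
  have hkn : k ≤ n := by
    have := natDegree_le_of_dvd hdvd (monic_X_pow_sub_C β hn).ne_zero
    rwa [natDegree_X_pow_sub_C] at this
  have hk0 : 0 < k := minpoly.natDegree_pos hint
  have hmem : ρ ^ k ∈ (algebraMap L Ω).fieldRange := by
    set P := ((minpoly L ρ).map (algebraMap L Ω)) with hP
    have hsplit : P.Splits := IsAlgClosed.splits P
    have hmonic : P.Monic := (minpoly.monic hint).map _
    have hcard : P.roots.card = k := by
      rw [← hsplit.natDegree_eq_card_roots, hP, natDegree_map]
    have hprod : P.roots.prod ^ n = (ρ ^ k) ^ n := by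
      have h1 : ∀ r ∈ P.roots, r ^ n = ρ ^ n := by
        intro r hr
        rw [mem_roots hmonic.ne_zero] at hr
        have h2 : aeval r (X ^ n - C β) = 0 := by
          obtain ⟨q, hq⟩ := hdvd
          rw [hq, map_mul]
          have : aeval r (minpoly L ρ) = 0 := by
            rw [← eval_map_algebraMap]; exact hr
          rw [this, zero_mul]
        rw [hρ]
        simpa [sub_eq_zero] using h2
      have h2 : (P.roots.map (· ^ n)).prod = P.roots.prod ^ n := by
        rw [Multiset.prod_map_pow, Multiset.map_id']
      rw [← h2, Multiset.map_congr rfl h1, Multiset.map_const',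
        Multiset.prod_replicate, hcard, pow_right_comm]
    have hcoeff : P.roots.prod ∈ (algebraMap L Ω).fieldRange := by
      have h3 := hsplit.coeff_zero_eq_prod_roots_of_monic hmonic
      refine ⟨(-1) ^ k * (minpoly L ρ).coeff 0, ?_⟩
      have h4 : P.coeff 0 = algebraMap L Ω ((minpoly L ρ).coeff 0) := by rw [hP, coeff_map]
      have h5 : P.natDegree = k := by rw [hP, natDegree_map]
      rw [map_mul, map_pow, map_neg, map_one, ← h4, h3, h5, ← mul_assoc, ← mul_pow]
      simp
    have hR0 : P.roots.prod ≠ 0 := by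
      intro h
      rw [h, zero_pow hn] at hprod
      exact pow_ne_zero _ (pow_ne_zero _ hρ0) hprod.symm
    have hz := hμ (ρ ^ k / P.roots.prod) (by
      rw [div_pow, ← hprod, div_self (pow_ne_zero _ hR0)])
    have := (algebraMap L Ω).fieldRange.mul_mem hz hcoeff
    rwa [div_mul_cancel₀ _ hR0] at this
  -- the exponents `j` with `ρ ^ j ∈ L` form a group, so they include `gcd(k, n)`
  have hgcd : ρ ^ (Nat.gcd k n) ∈ (algebraMap L Ω).fieldRange := by
    have h1 : ρ ^ (Nat.gcd k n : ℤ) = (ρ ^ k) ^ (Nat.gcdA k n) * (ρ ^ n) ^ (Nat.gcdB k n) := by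
      rw [Nat.gcd_eq_gcd_ab, zpow_add₀ hρ0, zpow_mul, zpow_mul, zpow_natCast, zpow_natCast]
    rw [← zpow_natCast, h1]
    refine mul_mem (zpow_mem hmem _) (zpow_mem ?_ _)
    rw [hρ]
    exact ⟨β, rfl⟩
  obtain ⟨m, hm⟩ := Nat.gcd_dvd_right k n
  by_cases hm1 : m = 1
  · rw [hm1, mul_one] at hm
    exact le_antisymm hkn (Nat.le_of_dvd hk0 (hm ▸ Nat.gcd_dvd_left k n))
  · exfalso
    obtain ⟨p, hp, q, rfl⟩ := Nat.exists_prime_and_dvd hm1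
    obtain ⟨s, hs⟩ := hgcd
    refine hβ p hp ⟨Nat.gcd k n * q, ?_⟩ (s ^ q) ?_
    · rw [mul_left_comm, ← hm]
    · apply (algebraMap L Ω).injective
      rw [map_pow, map_pow, hs, ← pow_mul, ← pow_mul, mul_comm q p, ← hm, hρ]

/-! ### Degrees of cyclotomic-Kummer extensions -/

section Kummer

variable {F Ω : Type*} [Field F] [Field Ω] [Algebra F Ω]

theorem finrank_sup_adjoin_simple (L : IntermediateField F Ω) {ρ : Ω} (hρ : IsIntegral L ρ) :
    Module.finrank F (L ⊔ F⟮ρ⟯ : IntermediateField F Ω) =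
      Module.finrank F L * (minpoly L ρ).natDegree := by
  rw [← restrictScalars_adjoin_eq_sup, ← IntermediateField.adjoin.finrank hρ]
  exact (Module.finrank_mul_finrank F L L⟮ρ⟯).symm

/-- All `m`-th roots of `β ^ h` are obtained from roots of unity and one root of `β` of order
`m / gcd(m, h)`. -/
theorem sup_adjoin_union_roots_eq [CharZero F] [IsAlgClosed Ω] {K : IntermediateField F Ω}
    {β : Ω} (hβ0 : β ≠ 0) (hβK : β ∈ K) {h m n : ℕ} (hm : m ≠ 0) (hmn : m ∣ n)
    {ρ : Ω} (hρ : ρ ^ (m / m.gcd h) = β) :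
    K ⊔ adjoin F ({z : Ω | z ^ n = 1} ∪ {z : Ω | z ^ m = β ^ h}) =
      K ⊔ cyclotomicSubfield F Ω n ⊔ F⟮ρ⟯ := by
  have hg : 0 < m.gcd h := Nat.gcd_pos_of_pos_left _ (Nat.pos_of_ne_zero hm)
  set g := m.gcd h with hgdef
  set m' := m / g with hm'
  set h' := h / g with hh'
  have hmg : m' * g = m := Nat.div_mul_cancel (Nat.gcd_dvd_left m h)
  have hhg : h' * g = h := Nat.div_mul_cancel (Nat.gcd_dvd_right m h)
  have hcop : Nat.Coprime m' h' := Nat.coprime_div_gcd_div_gcd hg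
  have hm'0 : m' ≠ 0 := by intro h0; rw [h0, zero_mul] at hmg; exact hm hmg.symm
  have hρ0 : ρ ≠ 0 := by rintro rfl; rw [zero_pow hm'0] at hρ; exact hβ0 hρ.symm
  -- one particular `m`-th root
  have hroot : (ρ ^ h') ^ m = β ^ h := by
    rw [← hρ, ← pow_mul, ← pow_mul, ← hmg, ← hhg]; congr 1; ring
  rw [adjoin_union, ← sup_assoc]
  apply le_antisymm
  · refine sup_le le_sup_left ?_
    rw [adjoin_le_iff]
    rintro z (hz : z ^ m = β ^ h)
    have h1 : z / ρ ^ h' ∈ K ⊔ cyclotomicSubfield F Ω n := by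
      refine (le_sup_right : cyclotomicSubfield F Ω n ≤ _)
        (cyclotomicSubfield_mono hmn (mem_cyclotomicSubfield ?_))
      rw [div_pow, hz, hroot, div_self (pow_ne_zero _ hβ0)]
    have h2 : ρ ∈ F⟮ρ⟯ := mem_adjoin_simple_self F ρ
    have h3 : z = z / ρ ^ h' * ρ ^ h' := (div_mul_cancel₀ _ (pow_ne_zero _ hρ0)).symm
    rw [h3]
    exact mul_mem ((le_sup_left : K ⊔ cyclotomicSubfield F Ω n ≤ _) h1)
      (pow_mem ((le_sup_right : F⟮ρ⟯ ≤ _) h2) _)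
  · refine sup_le le_sup_left (adjoin_simple_le_iff.2 ?_)
    set E := K ⊔ adjoin F {z : Ω | z ^ n = 1} ⊔ adjoin F {z : Ω | z ^ m = β ^ h} with hE
    have h1 : ρ ^ h' ∈ E := (le_sup_right : adjoin F {z : Ω | z ^ m = β ^ h} ≤ E)
      (subset_adjoin F _ hroot)
    have h2 : ρ ^ m' ∈ E := by
      rw [hρ]
      exact (le_sup_left.trans le_sup_left : K ≤ E) hβK
    have h3 : ρ = (ρ ^ m') ^ (Nat.gcdA m' h') * (ρ ^ h') ^ (Nat.gcdB m' h') := by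
      have h4 := Nat.gcd_eq_gcd_ab m' h'
      rw [hcop.gcd_eq_one] at h4
      rw [← zpow_natCast, ← zpow_natCast, ← zpow_mul, ← zpow_mul, ← zpow_add₀ hρ0, ← h4]
      simp
    rw [h3]
    exact mul_mem (zpow_mem h2 _) (zpow_mem h1 _)

end Kummer

section Rational

variable {Ω : Type*} [Field Ω] [Algebra ℚ Ω] [IsAlgClosed Ω] [IsGalois ℚ Ω]
  {K : IntermediateField ℚ Ω}

omit [IsGalois ℚ Ω] in
theorem finrank_sup_cyclotomicSubfield (hK : Module.finrank ℚ K = 2) {n : ℕ} (hn : n ≠ 0)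
    [Decidable (K ≤ cyclotomicSubfield ℚ Ω n)] :
    Module.finrank ℚ (K ⊔ cyclotomicSubfield ℚ Ω n : IntermediateField ℚ Ω) =
      if K ≤ cyclotomicSubfield ℚ Ω n then n.totient else 2 * n.totient := by
  split_ifs with h
  · rw [sup_eq_right.2 h, finrank_cyclotomicSubfield hn]
  · have : NeZero n := ⟨hn⟩
    have h1 := isCyclotomicExtension_cyclotomicSubfield (F := ℚ) (Ω := Ω) hn
    have h2 := isGalois_cyclotomicSubfield (F := ℚ) (Ω := Ω) hn
    have h3 : FiniteDimensional ℚ K := Module.finite_of_finrank_pos (by omega)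
    have h4 : FiniteDimensional ℚ (cyclotomicSubfield ℚ Ω n) :=
      Module.finite_of_finrank_pos (by
        rw [finrank_cyclotomicSubfield hn]; exact Nat.totient_pos.2 (Nat.pos_of_ne_zero hn))
    have h5 : cyclotomicSubfield ℚ Ω n ⊓ K = ⊥ := by
      rcases eq_bot_or_eq_of_le_of_finrank_eq_two hK
        (inf_le_right : cyclotomicSubfield ℚ Ω n ⊓ K ≤ K) with h5 | h5
      · exact h5
      · exact absurd (inf_eq_right.1 h5) h
    have h6 := IntermediateField.LinearDisjoint.of_inf_eq_bot h5
    rw [sup_comm, h6.finrank_sup, hK, finrank_cyclotomicSubfield hn, mul_comm]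

omit [IsGalois ℚ Ω] in
/-- A real quadratic field contains no root of unity of odd prime order `p`: by degree, `p = 3`,
and then `2 ζ + 1` is a square root of `-3`. -/
theorem not_mem_of_isPrimitiveRoot (hK : Module.finrank ℚ K = 2)
    (hreal : ∀ r : ℕ, 0 < r → ∀ j ∈ K, j ^ 2 ≠ -(r : Ω)) {p : ℕ} (hp : p.Prime) (hp2 : p ≠ 2)
    {ζ : Ω} (hζ : IsPrimitiveRoot ζ p) : ζ ∉ K := by
  intro hmem
  have hφ := finrank_cyclotomicSubfield (Ω := Ω) hp.ne_zero
  rw [Nat.totient_prime hp] at hφ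
  have hp1 := hp.two_le
  rcases eq_bot_or_eq_of_le_of_finrank_eq_two hK
    (cyclotomicSubfield_le_of_mem (F := ℚ) hp.ne_zero hζ hmem) with h | h
  · rw [h, IntermediateField.finrank_bot] at hφ
    omega
  · rw [h, hK] at hφ
    obtain rfl : p = 3 := by omega
    have h3 : ζ ^ 2 + ζ + 1 = 0 := by
      have := hζ.geom_sum_eq_zero (by norm_num)
      simp only [Finset.sum_range_succ, Finset.sum_range_zero] at this
      linear_combination this
    refine hreal 3 (by norm_num) (2 * ζ + 1)
      (add_mem (mul_mem (K.natCast_mem 2) hmem) (one_mem _)) ?_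
    push_cast
    linear_combination 4 * h3

/-- In the abelian field `K(ζ_n)` over `ℚ`, with `K` real, an element `β` of norm `-1` of `K` is a
`p`-th power only if it is one in `K`. -/
theorem pow_ne_of_mem_sup_cyclotomicSubfield (hK : Module.finrank ℚ K = 2)
    (hreal : ∀ r : ℕ, 0 < r → ∀ j ∈ K, j ^ 2 ≠ -(r : Ω))
    {σ : Ω ≃ₐ[ℚ] Ω} {β : Ω} (hβK : β ∈ K) (hβ : β * σ β = -1) {n : ℕ}
    (hn : n ≠ 0) {p : ℕ} (hp : p.Prime) (hβp : ∀ y ∈ K, y ^ p ≠ β)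
    {s : Ω} (hs : s ∈ K ⊔ cyclotomicSubfield ℚ Ω n) : s ^ p ≠ β := by
  have hcomm : ∀ τ₁ τ₂ : Ω ≃ₐ[ℚ] Ω, τ₁ (τ₂ s) = τ₂ (τ₁ s) :=
    fun τ₁ τ₂ => comm_apply_of_mem_sup hK hn τ₁ τ₂ hs
  by_cases hp2 : p = 2
  · subst hp2
    refine sq_ne_of_mul_conj_eq_neg_one (fun j hj => ?_) hβK hβ fun τ => hcomm τ σ
    simpa using hreal 1 one_pos j hj
  · intro hsβ
    obtain ⟨ζ, hζ⟩ := exists_isPrimitiveRoot_of_isAlgClosed (F := ℚ) (Ω := Ω) hp.ne_zero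
    have hβ0 : β ≠ 0 := by rintro rfl; simp at hβ
    obtain ⟨y, hy, hyβ⟩ := exists_pow_eq_of_comm hp hζ
      (not_mem_of_isPrimitiveRoot hK hreal hp hp2 hζ) hβ0 hβK hsβ hcomm
    exact hβp y hy hyβ

/-- The degree of the cyclotomic-Kummer field attached to `γ = β ^ h`. -/
theorem finrank_sup_adjoin_union_roots (hK : Module.finrank ℚ K = 2)
    (hreal : ∀ r : ℕ, 0 < r → ∀ j ∈ K, j ^ 2 ≠ -(r : Ω))
    {σ : Ω ≃ₐ[ℚ] Ω} {β : Ω} (hβK : β ∈ K) (hβ : β * σ β = -1)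
    (hβp : ∀ p : ℕ, p.Prime → ∀ y ∈ K, y ^ p ≠ β) {h m n : ℕ} (hn : n ≠ 0) (hmn : m ∣ n)
    [Decidable (K ≤ cyclotomicSubfield ℚ Ω n)] :
    Module.finrank ℚ (K ⊔ adjoin ℚ ({z : Ω | z ^ n = 1} ∪ {z : Ω | z ^ m = β ^ h}) :
      IntermediateField ℚ Ω) =
      (if K ≤ cyclotomicSubfield ℚ Ω n then n.totient else 2 * n.totient) * (m / m.gcd h) := by
  have hm : m ≠ 0 := by rintro rfl; exact hn (zero_dvd_iff.1 hmn)
  have hβ0 : β ≠ 0 := by rintro rfl; simp at hβ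
  have hg := Nat.gcd_dvd_left m h
  have hm' : m / m.gcd h ≠ 0 :=
    (Nat.div_pos (Nat.le_of_dvd (Nat.pos_of_ne_zero hm) hg)
      (Nat.gcd_pos_of_pos_left _ (Nat.pos_of_ne_zero hm))).ne'
  obtain ⟨ρ, hρ⟩ := IsAlgClosed.exists_pow_nat_eq β (Nat.pos_of_ne_zero hm')
  set L := K ⊔ cyclotomicSubfield ℚ Ω n with hL
  have hβL : β ∈ L := (le_sup_left : K ≤ L) hβK
  have hdeg : (minpoly L ρ).natDegree = m / m.gcd h := by
    refine natDegree_minpoly_eq_of_pow_eq hm' (β := (⟨β, hβL⟩ : L)) ?_ ?_ ?_ hρ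
    · intro h0; exact hβ0 (congrArg Subtype.val h0)
    · intro z hz
      have hzn : z ∈ cyclotomicSubfield ℚ Ω n := cyclotomicSubfield_mono
        ((Nat.div_dvd_of_dvd hg).trans hmn) (mem_cyclotomicSubfield hz)
      exact ⟨⟨z, (le_sup_right : cyclotomicSubfield ℚ Ω n ≤ L) hzn⟩, rfl⟩
    · intro p hp _ s hs
      exact pow_ne_of_mem_sup_cyclotomicSubfield hK hreal hβK hβ hn hp (hβp p hp) s.2
        (congrArg Subtype.val hs)
  have hint : IsIntegral L ρ := by
    by_contra hni
    rw [minpoly.eq_zero hni, natDegree_zero] at hdeg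
    exact hm' hdeg.symm
  rw [sup_adjoin_union_roots_eq hβ0 hβK hm hmn hρ, finrank_sup_adjoin_simple L hint, hdeg,
    finrank_sup_cyclotomicSubfield hK hn]

end Rational

/-! ### The divisor sum -/

section Arithmetic

theorem dvdInfty_iff {n d : ℕ} : DvdInfty n d ↔ n ≠ 0 ∧ n.primeFactors ⊆ d.primeFactors :=
  Nat.mem_factoredNumbers_iff_primeFactors_subset

theorem DvdInfty.ne_zero {n d : ℕ} (h : DvdInfty n d) : n ≠ 0 := (dvdInfty_iff.1 h).1

theorem DvdInfty.mul {m n d : ℕ} (hm : DvdInfty m d) (hn : DvdInfty n d) : DvdInfty (m * n) d :=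
  Nat.mul_mem_factoredNumbers hm hn

theorem DvdInfty.of_dvd {m n d : ℕ} (hn : DvdInfty n d) (h : m ∣ n) : DvdInfty m d :=
  Nat.mem_factoredNumbers_of_dvd hn h

theorem dvdInfty_of_dvd {u d : ℕ} (hd : d ≠ 0) (h : u ∣ d) : DvdInfty u d :=
  dvdInfty_iff.2 ⟨ne_zero_of_dvd_ne_zero hd h, Nat.primeFactors_mono h hd⟩

theorem DvdInfty.factorization_eq_zero {n d q : ℕ} (h : DvdInfty n d) (hq : q ∉ d.primeFactors) :
    n.factorization q = 0 := by
  rw [← Finsupp.notMem_support_iff, Nat.support_factorization]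
  exact fun hmem => hq ((dvdInfty_iff.1 h).2 hmem)

theorem gcdInfty_ne_zero (n d : ℕ) : gcdInfty n d ≠ 0 :=
  Finset.prod_ne_zero_iff.2 fun _ hp => pow_ne_zero _ (Nat.prime_of_mem_primeFactors hp).ne_zero

theorem factorization_gcdInfty (n d q : ℕ) :
    (gcdInfty n d).factorization q = if q ∈ d.primeFactors then n.factorization q else 0 := by
  rw [gcdInfty, Nat.factorization_prod fun p hp =>
    pow_ne_zero _ (Nat.prime_of_mem_primeFactors hp).ne_zero, Finsupp.finsetSum_apply]
  rw [Finset.sum_congr rfl (g := fun p => if q = p then n.factorization q else 0)]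
  · rw [Finset.sum_ite_eq]
  · intro p hp
    rw [(Nat.prime_of_mem_primeFactors hp).factorization_pow, Finsupp.single_apply]
    split_ifs with h1 h2 h2
    · rw [h1]
    · exact absurd h1.symm h2
    · exact absurd h2.symm h1
    · rfl

theorem dvdInfty_gcdInfty (n d : ℕ) : DvdInfty (gcdInfty n d) d := by
  refine dvdInfty_iff.2 ⟨gcdInfty_ne_zero n d, fun q hq => ?_⟩
  by_contra hqd
  rw [← Nat.support_factorization, Finsupp.mem_support_iff, factorization_gcdInfty,
    if_neg hqd] at hq
  exact hq rfl

theorem totient_mul_of_dvdInfty {d v : ℕ} (hd : d ≠ 0) (hv : DvdInfty v d) :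
    (d * v).totient = d.totient * v := by
  have h := Nat.totient_eq_mul_prod_factors (d * v)
  rw [Nat.primeFactors_mul hd hv.ne_zero, Finset.union_eq_left.2 (dvdInfty_iff.1 hv).2] at h
  have h' := Nat.totient_eq_mul_prod_factors d
  have : ((d * v).totient : ℚ) = ((d.totient * v : ℕ) : ℚ) := by
    rw [h]; push_cast; rw [h']; ring
  exact_mod_cast this

theorem gcd_eq_gcdInfty {h d x : ℕ} (hh : h ≠ 0) (hx : DvdInfty x d) (hdvd : gcdInfty h d ∣ x) :
    x.gcd h = gcdInfty h d := by
  refine Nat.eq_of_factorization_eq (Nat.gcd_ne_zero_right hh) (gcdInfty_ne_zero h d) fun q => ?_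
  rw [Nat.factorization_gcd hx.ne_zero hh, factorization_gcdInfty, Finsupp.inf_apply]
  split_ifs with hq
  · have := (Nat.factorization_le_iff_dvd (gcdInfty_ne_zero h d) hx.ne_zero).2 hdvd q
    rw [factorization_gcdInfty, if_pos hq] at this
    exact inf_eq_right.2 this
  · rw [hx.factorization_eq_zero hq]
    simp

theorem gcd_prime_mul {p x h : ℕ} (hp : p.Prime) (hx : x ≠ 0) (hh : h ≠ 0)
    (hlt : x.factorization p < h.factorization p) : (p * x).gcd h = p * x.gcd h := by
  have hg : x.gcd h ≠ 0 := Nat.gcd_ne_zero_right hh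
  refine Nat.eq_of_factorization_eq (Nat.gcd_ne_zero_right hh)
    (mul_ne_zero hp.ne_zero hg) fun q => ?_
  rw [Nat.factorization_gcd (mul_ne_zero hp.ne_zero hx) hh, Finsupp.inf_apply,
    Nat.factorization_mul hp.ne_zero hx, Nat.factorization_mul hp.ne_zero hg,
    Nat.factorization_gcd hx hh, Finsupp.add_apply, Finsupp.add_apply, Finsupp.inf_apply,
    hp.factorization, Finsupp.single_apply]
  split_ifs with hq
  · subst hq; omega
  · omega

theorem sum_divisors_moebius_div (d : ℕ) (hd : d ≠ 0) :
    ∑ u ∈ d.divisors, (ArithmeticFunction.moebius u : ℝ) / u = d.totient / d := by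
  have h := (ArithmeticFunction.sum_eq_iff_sum_mul_moebius_eq (R := ℝ)
    (f := fun n => (n.totient : ℝ)) (g := fun n => (n : ℝ))).1
    (fun n _ => by exact_mod_cast Nat.sum_totient n) d (Nat.pos_of_ne_zero hd)
  rw [Nat.sum_divisorsAntidiagonal
    (f := fun i j => ((ArithmeticFunction.moebius i : ℤ) : ℝ) * (j : ℝ))] at h
  rw [← h, Finset.sum_div]
  refine Finset.sum_congr rfl fun u hu => ?_
  have hud := Nat.dvd_of_mem_divisors hu
  have hu0 : (u : ℝ) ≠ 0 := Nat.cast_ne_zero.2 (ne_zero_of_dvd_ne_zero hd hud)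
  have hd0 : (d : ℝ) ≠ 0 := Nat.cast_ne_zero.2 hd
  rw [Nat.cast_div hud hu0]
  field_simp

/-- The terms of the divisor sum attached to `u` and `p * u` cancel whenever `p` divides `h` to a
higher power than `v`. -/
theorem sum_divisors_moebius_mul_gcd_eq_zero {d h v p : ℕ} (hd : d ≠ 0) (hh : h ≠ 0) (hv : v ≠ 0)
    (hp : p.Prime) (hpd : p ∣ d) (hlt : v.factorization p < h.factorization p) :
    ∑ u ∈ d.divisors, (ArithmeticFunction.moebius u : ℝ) * ((u * v).gcd h : ℝ) / u = 0 := by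
  have hpr : (p : ℝ) ≠ 0 := Nat.cast_ne_zero.2 hp.ne_zero
  rw [← Finset.sum_filter_of_ne (p := Squarefree)]
  swap
  · intro u _ hu
    by_contra hsq
    rw [ArithmeticFunction.moebius_eq_zero_of_not_squarefree hsq] at hu
    simp at hu
  have key : ∀ u, u ≠ 0 → ¬ p ∣ u →
      (ArithmeticFunction.moebius (p * u) : ℝ) * ((p * u * v).gcd h : ℝ) / (p * u : ℕ) =
        -((ArithmeticFunction.moebius u : ℝ) * ((u * v).gcd h : ℝ) / u) := by
    intro u hu hpu
    have h1 : (p * u * v).gcd h = p * (u * v).gcd h := by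
      rw [mul_assoc]
      refine gcd_prime_mul hp (mul_ne_zero hu hv) hh ?_
      rw [Nat.factorization_mul hu hv, Finsupp.add_apply, Nat.factorization_eq_zero_of_not_dvd hpu,
        zero_add]
      exact hlt
    rw [h1, ArithmeticFunction.isMultiplicative_moebius.map_mul_of_coprime
      ((Nat.Prime.coprime_iff_not_dvd hp).2 hpu), ArithmeticFunction.moebius_apply_prime hp]
    have hu' : (u : ℝ) ≠ 0 := Nat.cast_ne_zero.2 hu
    push_cast
    field_simp
  refine Finset.sum_involution (fun u _ => if p ∣ u then u / p else p * u) ?_ ?_ ?_ ?_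
  · intro u hu
    rw [Finset.mem_filter, Nat.mem_divisors] at hu
    have hu0 : u ≠ 0 := ne_zero_of_dvd_ne_zero hd hu.1.1
    split_ifs with hpu
    · obtain ⟨w, rfl⟩ := hpu
      rw [Nat.mul_div_cancel_left _ hp.pos]
      have hw0 : w ≠ 0 := right_ne_zero_of_mul hu0
      have hpw : ¬ p ∣ w := fun hpw =>
        hp.one_lt.ne' (Nat.isUnit_iff.1 (hu.2 p (mul_dvd_mul_left p hpw)))
      have := key w hw0 hpw
      rw [this]; ring
    · have := key u hu0 hpu
      rw [this]; ring
  · intro u hu _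
    rw [Finset.mem_filter, Nat.mem_divisors] at hu
    have hu0 : u ≠ 0 := ne_zero_of_dvd_ne_zero hd hu.1.1
    split_ifs with hpu
    · exact (Nat.div_lt_self (Nat.pos_of_ne_zero hu0) hp.one_lt).ne
    · intro h1
      exact hpu (Dvd.intro _ h1)
  · intro u hu
    rw [Finset.mem_filter, Nat.mem_divisors] at hu ⊢
    split_ifs with hpu
    · exact ⟨⟨(Nat.div_dvd_of_dvd hpu).trans hu.1.1, hd⟩,
        hu.2.squarefree_of_dvd (Nat.div_dvd_of_dvd hpu)⟩
    · have hcop := (Nat.Prime.coprime_iff_not_dvd hp).2 hpu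
      exact ⟨⟨hcop.mul_dvd_of_dvd_of_dvd hpd hu.1.1, hd⟩,
        (Nat.squarefree_mul hcop).2 ⟨hp.squarefree, hu.2⟩⟩
  · intro u hu
    rw [Finset.mem_filter, Nat.mem_divisors] at hu
    by_cases hpu : p ∣ u
    · obtain ⟨w, rfl⟩ := hpu
      have hpw : ¬ p ∣ w := fun hpw =>
        hp.one_lt.ne' (Nat.isUnit_iff.1 (hu.2 p (mul_dvd_mul_left p hpw)))
      simp [Nat.mul_div_cancel_left _ hp.pos, hpw]
    · simp [hpu, Nat.mul_div_cancel_left _ hp.pos]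

theorem sum_divisors_moebius_mul_gcd {d h v : ℕ} (hd : d ≠ 0) (hh : h ≠ 0) (hv : DvdInfty v d) :
    ∑ u ∈ d.divisors, (ArithmeticFunction.moebius u : ℝ) * ((u * v).gcd h : ℝ) / u =
      if gcdInfty h d ∣ v then (gcdInfty h d : ℝ) * (d.totient / d) else 0 := by
  split_ifs with hdvd
  · rw [← sum_divisors_moebius_div d hd, Finset.mul_sum]
    refine Finset.sum_congr rfl fun u hu => ?_
    rw [gcd_eq_gcdInfty hh ((dvdInfty_of_dvd hd (Nat.dvd_of_mem_divisors hu)).mul hv)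
      (hdvd.mul_left u)]
    ring
  · rw [← Nat.factorization_le_iff_dvd (gcdInfty_ne_zero h d) hv.ne_zero, Finsupp.le_def] at hdvd
    push Not at hdvd
    obtain ⟨p, hp⟩ := hdvd
    rw [factorization_gcdInfty] at hp
    split_ifs at hp with hpd
    · exact sum_divisors_moebius_mul_gcd_eq_zero hd hh hv.ne_zero
        (Nat.prime_of_mem_primeFactors hpd) (Nat.dvd_of_mem_primeFactors hpd) hp
    · exact absurd hp (Nat.not_lt_zero _)

end Arithmetic

/-! ### The series over `v` -/

section Series

theorem hasSum_dvdInfty_inv_sq (d : ℕ) :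
    HasSum (fun v : {v : ℕ // DvdInfty v d} => 1 / ((v : ℕ) : ℝ) ^ 2)
      (∏ p ∈ d.primeFactors, ((p : ℝ) ^ 2 / ((p : ℝ) ^ 2 - 1))) := by
  let f : ℕ →* ℝ :=
    { toFun := fun n => 1 / (n : ℝ) ^ 2
      map_one' := by simp
      map_mul' := fun m n => by push_cast; ring }
  have hp2 : ∀ {p : ℕ}, p.Prime → 1 < (p : ℝ) ^ 2 := fun {p} hp =>
    one_lt_pow₀ (by exact_mod_cast hp.one_lt) two_ne_zero
  have hf : ∀ {p : ℕ}, p.Prime → ‖f p‖ < 1 := by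
    intro p hp
    have h1 : f p = 1 / (p : ℝ) ^ 2 := rfl
    rw [h1, Real.norm_of_nonneg (by positivity), div_lt_one (by linarith [hp2 hp])]
    exact hp2 hp
  have h := (EulerProduct.summable_and_hasSum_factoredNumbers_prod_filter_prime_geometric hf
    d.primeFactors).2
  have hprod : ∏ p ∈ d.primeFactors with p.Prime, (1 - f p)⁻¹ =
      ∏ p ∈ d.primeFactors, ((p : ℝ) ^ 2 / ((p : ℝ) ^ 2 - 1)) := by
    rw [Finset.filter_true_of_mem fun p hp => Nat.prime_of_mem_primeFactors hp]
    refine Finset.prod_congr rfl fun p hp => ?_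
    have h1 : f p = 1 / (p : ℝ) ^ 2 := rfl
    have h2 := hp2 (Nat.prime_of_mem_primeFactors hp)
    have h3 : (p : ℝ) ^ 2 ≠ 0 := by linarith
    have h4 : (p : ℝ) ^ 2 - 1 ≠ 0 := by linarith
    rw [h1, one_sub_div h3, inv_div]
  rw [hprod] at h
  exact h

open scoped Classical in
theorem hasSum_dvdInfty_inv_sq_of_dvd (d k : ℕ) :
    HasSum (fun v : {v : ℕ // DvdInfty v d} => if k ∣ (v : ℕ) then 1 / ((v : ℕ) : ℝ) ^ 2 else 0)
      (iverson (DvdInfty k d) *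
        (1 / (k : ℝ) ^ 2 * ∏ p ∈ d.primeFactors, ((p : ℝ) ^ 2 / ((p : ℝ) ^ 2 - 1)))) := by
  by_cases hk : DvdInfty k d
  · have h1 : iverson (DvdInfty k d) = 1 := by rw [iverson, if_pos hk]
    rw [h1, one_mul]
    -- the multiples of `k` are reindexed by their quotients by `k`
    let g : {v : ℕ // DvdInfty v d} → {v : ℕ // DvdInfty v d} := fun v => ⟨k * v, hk.mul v.2⟩
    have hg : Function.Injective g := by
      intro v w hvw
      exact Subtype.ext (Nat.eq_of_mul_eq_mul_left (Nat.pos_of_ne_zero hk.ne_zero)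
        (congrArg Subtype.val hvw))
    rw [← hg.hasSum_iff]
    · have h2 := (hasSum_dvdInfty_inv_sq d).mul_left (1 / (k : ℝ) ^ 2)
      refine (congrArg (HasSum · _) (funext fun v => ?_)).mpr h2
      have h3 : ((g v : {v : ℕ // DvdInfty v d}) : ℕ) = k * v := rfl
      rw [Function.comp_apply, h3, if_pos (Dvd.intro _ rfl)]
      push_cast
      rw [mul_pow, one_div_mul_one_div]
    · intro v hv
      rw [if_neg]
      rintro ⟨w, hw⟩
      exact hv ⟨⟨w, v.2.of_dvd (hw ▸ Dvd.intro_left _ rfl)⟩, Subtype.ext hw.symm⟩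
  · have h1 : iverson (DvdInfty k d) = 0 := by rw [iverson, if_neg hk]
    rw [h1, zero_mul]
    convert hasSum_zero using 2 with v
    rw [if_neg fun hkv => hk (v.2.of_dvd hkv)]

end Series

/-! ### The terms of the series -/

section Terms

instance isGalois_QBar : IsGalois ℚ QBar := by
  have h : Algebra.IsAlgebraic ℚ QBar := AlgebraicClosure.isAlgebraic ℚ
  have : Normal ℚ QBar := normal_iff.2 fun x => ⟨(h.isAlgebraic x).isIntegral, IsAlgClosed.splits _⟩
  exact ⟨⟩

theorem dvd_mul_iff_div_gcd_dvd {Δ d v : ℕ} (hd : d ≠ 0) : Δ ∣ d * v ↔ Δ / d.gcd Δ ∣ v := by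
  have hg : 0 < d.gcd Δ := Nat.gcd_pos_of_pos_left _ (Nat.pos_of_ne_zero hd)
  have hcop : Nat.Coprime (Δ / d.gcd Δ) (d / d.gcd Δ) :=
    (Nat.coprime_div_gcd_div_gcd hg).symm
  have h1 : Δ ∣ d * v ↔ Δ / d.gcd Δ * d.gcd Δ ∣ d / d.gcd Δ * d.gcd Δ * v := by
    rw [Nat.div_mul_cancel (Nat.gcd_dvd_right d Δ), Nat.div_mul_cancel (Nat.gcd_dvd_left d Δ)]
  rw [h1, mul_right_comm, Nat.mul_dvd_mul_iff_right hg]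
  exact ⟨hcop.dvd_of_dvd_mul_left, fun h => h.mul_left _⟩

open scoped Classical in
theorem deltaPlusTerm_eq {K : IntermediateField ℚ QBar} (hK : Module.finrank ℚ K = 2)
    (hreal : ∀ r : ℕ, 0 < r → ∀ j ∈ K, j ^ 2 ≠ -(r : QBar))
    {σ : QBar ≃ₐ[ℚ] QBar} {β : QBar} (hβK : β ∈ K) (hβ : β * σ β = -1)
    (hβp : ∀ p : ℕ, p.Prime → ∀ y ∈ K, y ^ p ≠ β) {h : ℕ} (hh : h ≠ 0) {γ : K}
    (hγ : (γ : QBar) = β ^ h) {d : ℕ} (hd : d ≠ 0) (hd2 : 2 ∣ d) {Δ : ℕ}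
    (hΔ : ∀ n : ℕ, n ≠ 0 → 2 ∣ n → (K ≤ cyclotomicSubfield ℚ QBar n ↔ Δ ∣ n))
    {v : ℕ} (hv : DvdInfty v d) :
    deltaPlusTerm K γ d v = (gcdInfty h d : ℝ) / (2 * d) *
      ((if gcdInfty h d ∣ v then 1 / (v : ℝ) ^ 2 else 0) +
        if (gcdInfty h d).lcm (Δ / d.gcd Δ) ∣ v then 1 / (v : ℝ) ^ 2 else 0) := by
  have hdv : d * v ≠ 0 := mul_ne_zero hd hv.ne_zero
  have hφ : ((d * v).totient : ℝ) = d.totient * v := by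
    exact_mod_cast totient_mul_of_dvdInfty hd hv
  have hφ0 : (d.totient : ℝ) ≠ 0 :=
    Nat.cast_ne_zero.2 (Nat.totient_pos.2 (Nat.pos_of_ne_zero hd)).ne'
  have hd0 : (d : ℝ) ≠ 0 := Nat.cast_ne_zero.2 hd
  have hv0 : (v : ℝ) ≠ 0 := Nat.cast_ne_zero.2 hv.ne_zero
  set ε : ℝ := if Δ / d.gcd Δ ∣ v then 2 else 1 with hε
  have hKv : K ≤ cyclotomicSubfield ℚ QBar (d * v) ↔ Δ / d.gcd Δ ∣ v :=
    (hΔ _ hdv (hd2.mul_right v)).trans (dvd_mul_iff_div_gcd_dvd hd)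
  have hterm : ∀ u ∈ d.divisors,
      (ArithmeticFunction.moebius u : ℝ) /
        (Module.finrank ℚ (kummerField K γ (d * v) (u * v)) : ℝ) =
      ε / (2 * d.totient * v ^ 2) *
        ((ArithmeticFunction.moebius u : ℝ) * ((u * v).gcd h : ℝ) / u) := by
    intro u hu
    have hud := Nat.dvd_of_mem_divisors hu
    have hu0 : (u : ℝ) ≠ 0 := Nat.cast_ne_zero.2 (ne_zero_of_dvd_ne_zero hd hud)
    have hg0 : ((u * v).gcd h : ℝ) ≠ 0 := Nat.cast_ne_zero.2 (Nat.gcd_ne_zero_right hh)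
    rw [kummerField, hγ, finrank_sup_adjoin_union_roots hK hreal hβK hβ hβp hdv
      (mul_dvd_mul_right hud v), Nat.cast_mul, Nat.cast_div (Nat.gcd_dvd_left _ _) hg0]
    simp only [hKv]
    rw [hε]
    split_ifs
    · rw [hφ]; push_cast; field_simp
    · push_cast; rw [hφ]; field_simp
  rw [deltaPlusTerm, Finset.sum_congr rfl hterm, ← Finset.mul_sum,
    sum_divisors_moebius_mul_gcd hd hh hv, hε]
  simp only [Nat.lcm_dvd_iff]
  by_cases h1 : gcdInfty h d ∣ v <;> by_cases h2 : Δ / d.gcd Δ ∣ v <;>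
    simp only [h1, h2, if_true, if_false, and_self, and_true, and_false]
  · field_simp; ring
  · field_simp; simp
  · simp
  · simp

open scoped Classical in
theorem iverson_lcm_gcdInfty (h d e : ℕ) :
    iverson (DvdInfty ((gcdInfty h d).lcm e) d) = iverson (DvdInfty e d) := by
  have : DvdInfty ((gcdInfty h d).lcm e) d ↔ DvdInfty e d :=
    ⟨fun H => H.of_dvd (Nat.dvd_lcm_right _ _),
      fun H => ((dvdInfty_gcdInfty h d).mul H).of_dvd (Nat.lcm_dvd_mul _ _)⟩
  rw [this]

theorem hasSum_deltaPlusTerm {K : IntermediateField ℚ QBar} (hK : Module.finrank ℚ K = 2)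
    (hreal : ∀ r : ℕ, 0 < r → ∀ j ∈ K, j ^ 2 ≠ -(r : QBar))
    {σ : QBar ≃ₐ[ℚ] QBar} {β : QBar} (hβK : β ∈ K) (hβ : β * σ β = -1)
    (hβp : ∀ p : ℕ, p.Prime → ∀ y ∈ K, y ^ p ≠ β) {h : ℕ} (hh : h ≠ 0) {γ : K}
    (hγ : (γ : QBar) = β ^ h) {d : ℕ} (hd : d ≠ 0) (hd2 : 2 ∣ d) {Δ : ℕ}
    (hΔ : ∀ n : ℕ, n ≠ 0 → 2 ∣ n → (K ≤ cyclotomicSubfield ℚ QBar n ↔ Δ ∣ n)) :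
    HasSum (fun v : {v : ℕ // DvdInfty v d} => deltaPlusTerm K γ d v)
      (1 / (2 * (d : ℝ)) *
        (1 / (gcdInfty h d : ℝ) +
          iverson (DvdInfty (Δ / d.gcd Δ) d) *
            ((gcdInfty h d : ℝ) / (Nat.lcm (gcdInfty h d) (Δ / d.gcd Δ) : ℝ) ^ 2)) *
        ∏ p ∈ d.primeFactors, ((p : ℝ) ^ 2 / ((p : ℝ) ^ 2 - 1))) := by
  classical
  have hs := ((hasSum_dvdInfty_inv_sq_of_dvd d (gcdInfty h d)).add
    (hasSum_dvdInfty_inv_sq_of_dvd d ((gcdInfty h d).lcm (Δ / d.gcd Δ)))).mul_left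
    ((gcdInfty h d : ℝ) / (2 * d))
  have hfun : (fun v : {v : ℕ // DvdInfty v d} => deltaPlusTerm K γ d v) = _ :=
    funext fun v => deltaPlusTerm_eq hK hreal hβK hβ hβp hh hγ hd hd2 hΔ v.2
  rw [hfun]
  refine (congrArg (HasSum _ ·) ?_).mpr hs
  have hH : (gcdInfty h d : ℝ) ≠ 0 := Nat.cast_ne_zero.2 (gcdInfty_ne_zero h d)
  have hd0 : (d : ℝ) ≠ 0 := Nat.cast_ne_zero.2 hd
  have h1 : iverson (DvdInfty (gcdInfty h d) d) = 1 := by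
    rw [iverson, if_pos (dvdInfty_gcdInfty h d)]
  rw [iverson_lcm_gcdInfty, h1, one_mul]
  generalize (∏ p ∈ d.primeFactors, ((p : ℝ) ^ 2 / ((p : ℝ) ^ 2 - 1))) = P
  field_simp

end Terms

/-! ### The root of `γ` of norm `-1` -/

section Root

theorem eq_one_or_eq_neg_one_of_pow_two_pow {F Ω : Type*} [Field F] [Field Ω] [Algebra F Ω]
    {K : IntermediateField F Ω} (hi : ∀ j ∈ K, j ^ 2 ≠ -1) {k : ℕ} {z : Ω} (hz : z ∈ K)
    (h : z ^ 2 ^ k = 1) : z = 1 ∨ z = -1 := by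
  induction k with
  | zero => left; simpa using h
  | succ k ih =>
    rw [pow_succ, pow_mul] at h
    rcases sq_eq_sq_iff_eq_or_eq_neg.1 (h.trans (one_pow 2).symm) with h | h
    · exact ih h
    · cases k with
      | zero => right; simpa using h
      | succ l =>
        rw [pow_succ, pow_mul] at h
        exact absurd h (hi _ (pow_mem hz _))

theorem powerIndexAt_spec {K : Type*} [Field K] {γ : K} (hγ : γ ≠ 0) (h0 : powerIndexAt γ 1 ≠ 0) :
    (∃ β : K, β ^ powerIndexAt γ 1 = γ) ∧
      ∀ n : ℕ, 1 ≤ n → ∀ β : K, β ^ n = γ → n ≤ powerIndexAt γ 1 := by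
  set S := {n : ℕ | 1 ≤ n ∧ ∃ β : K, β ≠ 0 ∧ β ^ n = 1 * γ} with hS
  have hbdd : BddAbove S := by
    by_contra hb
    exact h0 (Nat.sSup_of_not_bddAbove hb)
  have hne : S.Nonempty := ⟨1, le_rfl, γ, hγ, by ring⟩
  obtain ⟨-, β, -, hβ⟩ := Nat.sSup_mem hne hbdd
  refine ⟨⟨β, by rw [powerIndexAt, hβ, one_mul]⟩, fun n hn β hβ => le_csSup hbdd ⟨hn, β, ?_, ?_⟩⟩
  · rintro rfl
    rw [zero_pow (by omega)] at hβ
    exact hγ hβ.symm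
  · rw [hβ, one_mul]

theorem gcdInfty_two (n : ℕ) : gcdInfty n 2 = 2 ^ n.factorization 2 := by
  rw [gcdInfty, Nat.Prime.primeFactors Nat.prime_two, Finset.prod_singleton]

theorem exists_norm_ne_one_of_normBool_eq_zero {K : Type*} [Field K] [NumberField K] {γ : K}
    (h : normBool γ = 0) : ∃ η : K, η ^ gcdInfty (powerIndex γ) 2 = γ ∧ Algebra.norm ℚ η ≠ 1 := by
  by_contra! H
  rw [normBool, if_pos H] at h
  exact one_ne_zero h

end Root

/-! ### The roots of the Lucas polynomial -/

section Lucas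

theorem lucasPoly_natDegree (a₁ a₂ : ℤ) : (lucasPoly a₁ a₂).natDegree = 2 := by
  rw [lucasPoly]; compute_degree!

theorem lucasPoly_monic (a₁ a₂ : ℤ) : (lucasPoly a₁ a₂).Monic := by
  rw [lucasPoly]; monicity!

theorem mem_aroots_lucasPoly_iff {a₁ a₂ : ℤ} {x : QBar} :
    x ∈ (lucasPoly a₁ a₂).aroots QBar ↔ aeval x (lucasPoly a₁ a₂) = 0 := by
  rw [mem_aroots]
  exact and_iff_right (lucasPoly_monic a₁ a₂).ne_zero

theorem finrank_adjoin_root_lucasPoly {a₁ a₂ : ℤ} (hirr : Irreducible (lucasPoly a₁ a₂))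
    {a : QBar} (ha : aeval a (lucasPoly a₁ a₂) = 0) : Module.finrank ℚ ℚ⟮a⟯ = 2 := by
  have hmin := minpoly.eq_of_irreducible_of_monic hirr ha (lucasPoly_monic a₁ a₂)
  rw [IntermediateField.adjoin.finrank ⟨_, lucasPoly_monic a₁ a₂, ha⟩, ← hmin,
    lucasPoly_natDegree]

theorem ne_zero_of_aeval_lucasPoly {a₁ a₂ : ℤ} (ha₂ : a₂ ≠ 0) {x : QBar}
    (hx : aeval x (lucasPoly a₁ a₂) = 0) : x ≠ 0 := by
  rintro rfl
  have h : ((a₂ : ℚ) : QBar) = 0 := by simpa [lucasPoly] using hx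
  exact ha₂ (by exact_mod_cast h)

/-- The conjugation of `K = ℚ(a)` exchanges the roots `a` and `b`, so `γ = a / b` has norm `1`. -/
theorem mul_conj_div_roots_eq_one {a₁ a₂ : ℤ} (ha₂ : a₂ ≠ 0)
    (hirr : Irreducible (lucasPoly a₁ a₂)) {a b : QBar}
    (hroots : (lucasPoly a₁ a₂).aroots QBar = {a, b}) {σ : QBar ≃ₐ[ℚ] QBar}
    (hσ : ∃ x ∈ ℚ⟮a⟯, σ x ≠ x) : a / b * σ (a / b) = 1 := by
  have hroot : ∀ x : QBar, aeval x (lucasPoly a₁ a₂) = 0 ↔ x = a ∨ x = b := by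
    intro x
    rw [← mem_aroots_lucasPoly_iff, hroots]
    simp
  have ha := (hroot a).2 (Or.inl rfl)
  have hK := finrank_adjoin_root_lucasPoly hirr ha
  have ha0 := ne_zero_of_aeval_lucasPoly ha₂ ha
  have hb0 := ne_zero_of_aeval_lucasPoly ha₂ ((hroot b).2 (Or.inr rfl))
  have haK : a ∈ ℚ⟮a⟯ := mem_adjoin_simple_self ℚ a
  have hσa : aeval (σ a) (lucasPoly a₁ a₂) = 0 := by
    have := aeval_algHom_apply (σ : QBar →ₐ[ℚ] QBar) a (lucasPoly a₁ a₂)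
    rw [ha, map_zero] at this
    exact this
  rcases (hroot _).1 hσa with h | h
  · exfalso
    obtain ⟨x, hx, hne⟩ := hσ
    obtain ⟨r, s, rfl⟩ := (IntermediateField.mem_adjoin_simple_iff ℚ x).1 hx
    apply hne
    have hfix : ∀ r : ℚ[X], σ (aeval a r) = aeval a r := fun r => by
      conv_rhs => rw [← h]
      exact (aeval_algHom_apply (σ : QBar →ₐ[ℚ] QBar) a r).symm
    rw [map_div₀, hfix, hfix]
  · have hσb : σ b = a := by rw [← h]; exact conj_conj hK hσ haK
    rw [map_div₀, h, hσb]
    field_simp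

end Lucas

/-- The root `β` of `γ` of the maximal order `h` has norm `-1`, is not a perfect power in `K`, and
forces `K` to be real quadratic. -/
theorem exists_root_of_norm_eq_neg_one {K : IntermediateField ℚ QBar} [NumberField K]
    (hK : Module.finrank ℚ K = 2) {σ : QBar ≃ₐ[ℚ] QBar} (hσ : ∃ x ∈ K, σ x ≠ x) {γ : K}
    (hγ : (γ : QBar) * σ γ = 1) {h : ℕ} (hh : h = powerIndex γ) (hh1 : h = powerIndexAt γ 1)
    (hQ : normBool γ = 0) :
    ∃ (D : ℕ) (δ β : QBar), Squarefree D ∧ δ ∈ K ∧ δ ^ 2 = (D : QBar) ∧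
      (∀ q : ℚ, algebraMap ℚ QBar q ≠ δ) ∧ (∀ r : ℕ, 0 < r → ∀ j ∈ K, j ^ 2 ≠ -(r : QBar)) ∧
      β ∈ K ∧ β * σ β = -1 ∧ (∀ p : ℕ, p.Prime → ∀ y ∈ K, y ^ p ≠ β) ∧ h ≠ 0 ∧
      (γ : QBar) = β ^ h := by
  have hγ0 : γ ≠ 0 := by rintro rfl; simp at hγ
  obtain ⟨η, hη, hηN⟩ := exists_norm_ne_one_of_normBool_eq_zero hQ
  rw [← hh, gcdInfty_two] at hη
  have hη' : (η : QBar) ^ 2 ^ h.factorization 2 = γ := by rw [← hη]; rfl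
  -- norms are rational, so those with a power equal to `1` are `1` or `-1`
  have hrat : ∀ x : K, ∃ q : ℚ, algebraMap ℚ QBar q = x * σ x :=
    fun x => ⟨_, algebraMap_norm_eq_mul hK hσ x⟩
  have hηN' : (η : QBar) * σ η ≠ 1 := by
    intro h1
    apply hηN
    apply (algebraMap ℚ QBar).injective
    rw [map_one, ← h1, ← algebraMap_norm_eq_mul hK hσ]
    have h2 : (DivisionRing.toRatAlgebra : Algebra ℚ K) = K.algebra' := Subsingleton.elim _ _
    rw [h2]
  have hηN1 : (η : QBar) * σ η = -1 := by
    obtain ⟨q, hq⟩ := hrat η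
    have h1 : q ^ 2 ^ h.factorization 2 = 1 := by
      apply (algebraMap ℚ QBar).injective
      rw [map_pow, hq, mul_pow, ← map_pow, hη', hγ, map_one]
    rcases (pow_eq_one_iff_cases.1 h1) with h2 | h2 | h2
    · exact absurd h2 (pow_ne_zero _ two_ne_zero)
    · rw [h2, map_one] at hq
      exact absurd hq.symm hηN'
    · rw [← hq, h2.1, map_neg, map_one]
  -- `γ` itself has norm `1`, so `h` is even and non-zero
  have hfac : h.factorization 2 ≠ 0 := by
    intro h0
    rw [h0, pow_zero, pow_one] at hη'
    rw [hη'] at hηN'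
    exact hηN' hγ
  have hh0 : h ≠ 0 := by rintro rfl; simp at hfac
  obtain ⟨D, δ, hD, hD0, hδK, hδ, hδQ⟩ := exists_sqrt_of_mul_conj_eq_neg_one hK hσ η.2 hηN1
  have hreal : ∀ r : ℕ, 0 < r → ∀ j ∈ K, j ^ 2 ≠ -(r : QBar) := fun r hr j hj =>
    sq_ne_neg_of_sqrt_mem hK hδK hD0 hδ hδQ hr hj
  obtain ⟨⟨β, hβ⟩, hmax⟩ := powerIndexAt_spec hγ0 (hh1 ▸ hh0)
  rw [← hh1] at hβ hmax
  have hβ' : (β : QBar) ^ h = γ := by rw [← hβ]; rfl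
  obtain ⟨k, hk⟩ := Nat.ordProj_dvd h 2
  have hkodd : Odd k := by
    rw [← Nat.not_even_iff_odd, even_iff_two_dvd]
    have := Nat.not_dvd_ordCompl Nat.prime_two hh0
    have hk' : h / 2 ^ h.factorization 2 = k :=
      Nat.div_eq_of_eq_mul_right (pow_pos two_pos _) hk
    rwa [hk'] at this
  have hβ0 : (β : QBar) ≠ 0 := by
    intro h0
    rw [h0, zero_pow hh0] at hβ'
    rw [← hβ', zero_mul] at hγ
    exact zero_ne_one hγ
  refine ⟨D, δ, β, hD, hδK, hδ, hδQ, hreal, β.2, ?_, ?_, hh0, hβ'.symm⟩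
  · -- `η = ± β ^ k` with `k` odd
    have h1 : ((η : QBar) / β ^ k) ^ 2 ^ h.factorization 2 = 1 := by
      rw [div_pow, ← pow_mul, mul_comm k, ← hk, hβ', hη', div_self]
      exact fun h0 => hγ0 (Subtype.ext h0)
    have h2 := eq_one_or_eq_neg_one_of_pow_two_pow (K := K)
      (fun j hj => by simpa using hreal 1 one_pos j hj) (div_mem η.2 (pow_mem β.2 k)) h1
    obtain ⟨q, hq⟩ := hrat β
    have h3 : (algebraMap ℚ QBar q) ^ k = -1 := by
      rw [hq, ← hηN1, mul_pow, ← map_pow]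
      rcases h2 with h2 | h2 <;> rw [div_eq_iff (pow_ne_zero _ hβ0)] at h2 <;> rw [h2] <;> simp
    have h4 : q ^ k = (-1) ^ k := by
      apply (algebraMap ℚ QBar).injective
      rw [map_pow, h3, hkodd.neg_one_pow, map_neg, map_one]
    rw [← hq, hkodd.pow_injective h4, map_neg, map_one]
  · intro p hp y hy hyβ
    have h1 := hmax (p * h) (Nat.mul_pos hp.pos (Nat.pos_of_ne_zero hh0)) ⟨y, hy⟩ (by
      apply Subtype.ext
      change y ^ (p * h) = γ
      rw [pow_mul, hyβ, hβ'])
    have := hp.two_le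
    nlinarith [Nat.pos_of_ne_zero hh0]

theorem mainTheorem1 (a₁ a₂ : ℤ) (ha₁ : a₁ ≠ 0) (ha₂ : a₂ ≠ 0)
    (hirr : Irreducible (lucasPoly a₁ a₂))
    (a b : QBar) (hroots : (lucasPoly a₁ a₂).aroots QBar = {a, b})
    (γ : ℚ⟮a⟯) (hγ : (γ : QBar) = a / b) (hγunity : ∀ n : ℕ, 1 ≤ n → γ ^ n ≠ 1)
    (h : ℕ) (hh : h = powerIndex γ) (hh1 : h = powerIndexAt γ 1)
    (hQ : normBool γ = 0)
    (d : ℕ) (hd : 1 ≤ d) (hd2 : 2 ∣ d)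
    (e : ℕ) (he : e = discrQuot ℚ⟮a⟯ d) :
    Summable (fun v : {v : ℕ // DvdInfty v d} => deltaPlusTerm ℚ⟮a⟯ γ d v) ∧
    deltaPlus ℚ⟮a⟯ γ d =
      1 / (2 * (d : ℝ)) *
        (1 / (gcdInfty h d : ℝ) +
          iverson (DvdInfty e d) *
            ((gcdInfty h d : ℝ) / (Nat.lcm (gcdInfty h d) e : ℝ) ^ 2)) *
        ∏ p ∈ d.primeFactors, ((p : ℝ) ^ 2 / ((p : ℝ) ^ 2 - 1)) := by
  have ha : aeval a (lucasPoly a₁ a₂) = 0 := by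
    rw [← mem_aroots_lucasPoly_iff, hroots]; simp
  have hK := finrank_adjoin_root_lucasPoly hirr ha
  obtain ⟨σ, hσ⟩ := exists_algEquiv_ne_of_finrank_eq_two hK
  have hγN : (γ : QBar) * σ γ = 1 := by
    rw [hγ]; exact mul_conj_div_roots_eq_one ha₂ hirr hroots hσ
  obtain ⟨D, δ, β, hD, hδK, hδ, hδQ, hreal, hβK, hβ, hβp, hh0, hγβ⟩ :=
    exists_root_of_norm_eq_neg_one hK hσ hγN hh hh1 hQ
  have hd0 : d ≠ 0 := by omega
  have hs := hasSum_deltaPlusTerm hK hreal hβK hβ hβp hh0 hγβ hd0 hd2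
    (Δ := (NumberField.discr ℚ⟮a⟯).natAbs) fun n hn hn2 =>
      le_cyclotomicSubfield_iff_discr_dvd hK hD hδK hδ hδQ hn hn2
  rw [he, discrQuot]
  exact ⟨hs.summable, hs.tsum_eq⟩
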